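/- **Setting.** Let $\Bbbk$ be a commutative ring, $A=\bigoplus_{d\in\mathbb Z}A_d$ and $Z=\bigoplus_{d\in\mathbb Z} Z_d$ graded $\Bbbk$-modules, $\mathbb 1\in A_{-1}$ a fixed element, and $\omega:A\otimes A\to\Bbbk$ a bilinear form of some degree $|\omega|\in\mathbb Z$ (that is, $\omega(a,b)=0$ for homogeneous $a,b$ unless $|a|+|b|+|\omega|=0$) which is non-degenerate: $a\mapsto \omega(a,\cdot)$ is a bijection $A_d\to \mathrm{Hom}_\Bbbk(A_{-d-|\omega|},\Bbbk)$ for every $d$ (when the $A_d$ are finite-dimensional over a field this follows from ordinary non-degeneracy). A *Hochschild cochain* is a homogeneous element $D$ of $\prod_{(\ell,k)\ne(0,0)}\mathrm{Hom}(Z^{\wedge \ell}\otimes A^{\otimes k},A)$, where $Z^{\wedge\ell}$ is the graded symmetric power; $|D(z;a)|=|D|+|z|+|a|$. For an index set $J=\{j_1<j_2<\cdots\}$ put $z_J=z_{j_1}\wedge z_{j_2}\wedge\cdots$, $a_J=a_{j_1}\otimes a_{j_2}\otimes\cdots$. **Braces.** $D\{E_1,\dots,E_m\}(z_{[\ell]};a_{[k]})$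 is the sum, over all partitions $[\ell]=L_0\sqcup L_1\sqcup\dots\sqcup L_m$ and all decompositions of the word $a_1\cdots a_k$ into consecutive (possibly empty) blocks $I_0,K_1,I_1,\dots,K_m,I_m$, of $$(-1)^{*}D\big(z_{L_0};a_{I_0},E_1(z_{L_1};a_{K_1}),a_{I_1},\dots,E_m(z_{L_m};a_{K_m}),a_{I_m}\big),$$ $$*=\sum_{p=1}^m\Big(|a_{I_0}|+\sum_{q=1}^{p-1}(|a_{K_q}|+|a_{I_q}|)\Big)(|E_p|+|z_{L_p}|)+\sum_{p=1}^m|E_p|\sum_{q=0}^{p-1}|z_{L_q}|+\epsilon ,\qquad z_{[\ell]}=(-1)^\epsilon z_{L_0}\wedge z_{L_1}\wedge\dots\wedge z_{L_m}.$$ For $m=0$, $D\{\}=D$. **Cyclic braces.** The *first-order cyclic brace* $G=D\{E_1,\dots,E_s,\Delta,E_{s+1},\dots,E_m\}$ is the cochain of degree $|D|+\sum_p|E_p|-1$ determined, for $(\ell,k)\neq(0,0)$ and all $a_0$, by $$\omega\big(G(z_{[\ell]};a_{[k]}),a_0\big)=\sum_{r=0}^k(-1)^{|a_{[1,r]}|(|a_{[r+1,k]}|+|a_0|)}\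 \omega\big(X_r,\mathbb 1\big),$$ where $X_r$ consists of those terms, with their signs, in the brace formula for $D\{E_1,\dots,E_m\}(z_{[\ell]};a_{r+1},\dots,a_k,a_0,a_1,\dots,a_r)$ in which $a_0$ is a direct input of $D$ lying after $E_1,\dots,E_s$ and before $E_{s+1},\dots,E_m$. The *second-order cyclic brace* $$D\{E_1,\dots,E_{i-1},E_i\{F_1,\dots,F_j,\lozenge,F_{j+1},\dots,F_n\},E_{i+1},\dots,E_m\},$$ of degree $|D|+\sum_p|E_p|+\sum_q|F_q|-1$, is defined in the same way, with $X_r$ now consisting of those terms in the formula for the nested brace $D\{E_1,\dots,E_i\{F_1,\dots,F_n\},\dots,E_m\}(z_{[\ell]};a_{r+1},\dots,a_k,a_0,a_1,\dots,a_r)$ in which $a_0$ is a direct input of $E_i$ lying after $F_1,\dots,F_j$ and before $F_{j+1},\dots,F_n$. **Theorem 1.4 (Cyclic Brace Relations).** For all $m,n\ge 0$ and all Hochschild cochains $D,E_1,\dots,E_m,F_1,\dots,F_n$: (i) $$D\{E_1,\dots,E_m\}\{F_1,\dots,F_n,\Delta\}$$ $$=\sum_{s=0}^m\ \sum_{0\le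 i_1\le j_1\le\cdots\le i_s\le j_s\le n}(-1)^{t}\,D\big\{F_1,\dots,F_{i_1},E_1\{F_{i_1+1},\dots,F_{j_1}\},F_{j_1+1},\dots,F_{i_s},E_s\{F_{i_s+1},\dots,F_{j_s}\},F_{j_s+1},\dots,F_n,\Delta,E_{s+1},\dots,E_m\big\}$$ $$+\sum_{s=1}^m\ \sum_{0\le i_1\le j_1\le\cdots\le i_{s-1}\le j_{s-1}\le i_s\le n}(-1)^{t}\,D\big\{F_1,\dots,F_{i_1},E_1\{F_{i_1+1},\dots,F_{j_1}\},\dots,F_{i_s},E_s\{F_{i_s+1},\dots,F_n,\lozenge\},E_{s+1},\dots,E_m\big\},$$ where in both sums $$t=\sum_{k=1}^s|E_k|\sum_{a=1}^{i_k}|F_a|+\sum_{k=s+1}^m|E_k|\sum_{a=1}^n|F_a| .$$ (ii) $$D\{E_1,\dots,E_m,\Delta\}\{F_1,\dots,F_n\}$$ $$=\sum_{r=0}^n\ \sum_{r\le i_1\le j_1\le\cdots\le i_m\le j_m\le n}(-1)^{\tau}\,D\big\{F_{r+1},\dots,F_{i_1},E_1\{F_{i_1+1},\dots,F_{j_1}\},F_{j_1+1},\dots,F_{i_m},E_m\{F_{i_m+1},\dots,F_{j_m}\},F_{j_m+1},\dots,F_n,\Delta,F_1,\dots,F_r\big\},$$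 $$\tau=\sum_{k=1}^m|E_k|\sum_{a=r+1}^{i_k}|F_a|+\sum_{p=1}^r\sum_{q=r+1}^n|F_p||F_q| .$$ -/

import Mathlib

noncomputable section

namespace CyclicBrace

universe u v w

variable {𝕜 : Type u} [CommRing 𝕜]
variable {A : Type v} [AddCommGroup A] [Module 𝕜 A]
variable {Z : Type w} [AddCommGroup Z] [Module 𝕜 Z]

/-- A homogeneous element of a graded module, remembered together with its degree and with a
label `mark`. Ordinary inputs carry the trivial label in `Unit`; labels in `Bool` are used to single
out the distinguished input `a₀` of a cyclic brace. -/
@[ext]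
structure Letter (𝒜 : ℤ → Submodule 𝕜 A) (μ : Type) where
  deg : ℤ
  val : A
  mem : val ∈ 𝒜 deg
  mark : μ

/-- Change of label. -/
def Letter.relabel {𝒜 : ℤ → Submodule 𝕜 A} {μ ν : Type} (m : ν) (a : Letter 𝒜 μ) : Letter 𝒜 ν :=
  ⟨a.deg, a.val, a.mem, m⟩

/-- Total degree `|a₁| + ⋯ + |aₖ|` of a word. -/
def wt {𝒜 : ℤ → Submodule 𝕜 A} {μ : Type} (as : List (Letter 𝒜 μ)) : ℤ :=
  (as.map Letter.deg).sum

/-- A homogeneous element of `∏_{(ℓ,k) ≠ (0,0)} Hom(Z^{∧ℓ} ⊗ A^{⊗k}, A)`, given by its values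
`D(z₁,…,z_ℓ; a₁,…,aₖ)` on homogeneous elements. These are multilinear, graded symmetric in the `zᵢ`,
of degree `|D| + |z| + |a|`, and the component `(ℓ,k) = (0,0)` is absent (i.e. zero).
The `a`-inputs may carry labels, on which the value is allowed to depend. -/
structure Op (𝒵 : ℤ → Submodule 𝕜 Z) (𝒜 : ℤ → Submodule 𝕜 A) (μ : Type) where
  deg : ℤ
  toFun : List (Letter 𝒵 Unit) → List (Letter 𝒜 μ) → A
  mem : ∀ zs as, toFun zs as ∈ 𝒜 (deg + wt zs + wt as)
  nil : toFun [] [] = 0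
  lin_left : ∀ (l r : List (Letter 𝒵 Unit)) (as : List (Letter 𝒜 μ)) (d : ℤ),
    IsLinearMap 𝕜 (fun x : 𝒵 d => toFun (l ++ ⟨d, x.1, x.2, ()⟩ :: r) as)
  lin_right : ∀ (zs : List (Letter 𝒵 Unit)) (l r : List (Letter 𝒜 μ)) (d : ℤ) (m : μ),
    IsLinearMap 𝕜 (fun x : 𝒜 d => toFun zs (l ++ ⟨d, x.1, x.2, m⟩ :: r))
  symm : ∀ (l r : List (Letter 𝒵 Unit)) (x y : Letter 𝒵 Unit) (as : List (Letter 𝒜 μ)),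
    toFun (l ++ x :: y :: r) as = (x.deg * y.deg).negOnePow • toFun (l ++ y :: x :: r) as

/-- Homogeneous open-closed Hochschild cochains in `C^{•,•}(Z; A, A)`. -/
abbrev Cochain (𝒵 : ℤ → Submodule 𝕜 Z) (𝒜 : ℤ → Submodule 𝕜 A) := Op 𝒵 𝒜 Unit

variable {𝒵 : ℤ → Submodule 𝕜 Z} {𝒜 : ℤ → Submodule 𝕜 A} {μ : Type}

/-- `∑ f(u, v)` over all ways of cutting the word `as` into two consecutive pieces `u`, `v`. -/
def cutSum {α M : Type*} [AddCommMonoid M] (f : List α → List α → M) (as : List α) : M :=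
  ∑ r ∈ Finset.range (as.length + 1), f (as.take r) (as.drop r)

/-- `∑ (-1)^ε f(z_L, z_R)` over all partitions `[ℓ] = L ⊔ R` into ordered subsets, where
`z_{[ℓ]} = (-1)^ε z_L ∧ z_R`. -/
def unshuffleSum {M : Type*} [AddCommGroup M] :
    (List (Letter 𝒵 Unit) → List (Letter 𝒵 Unit) → M) → List (Letter 𝒵 Unit) → M
  | f, [] => f [] []
  | f, z :: zs =>
      unshuffleSum (fun L R => f (z :: L) R) zs +
      unshuffleSum (fun L R => (z.deg * wt L).negOnePow • f L (z :: R)) zs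

/-- The operations `E₁, …, E_m` are inserted one after the other.
`w` is the part of the word of inputs of `D` already formed, `ζ` is the total degree of the `z`'s
in the earlier blocks and `α` that of the `a`'s to the left. Each `E` gets a
block `L` of the `z`'s and a block `K` of consecutive `a`'s, preceded by a block `I` that is passed to
`D`; it contributes the sign `(α + |a_I|)(|E| + |z_L|) + ζ |E|`. At the end all
`z`'s must have been used, and the remaining `a`'s are passed to `D`. -/
def plug (D : Cochain 𝒵 𝒜) (L₀ : List (Letter 𝒵 Unit)) :
    List (Op 𝒵 𝒜 μ) → ℤ → ℤ → List (Letter 𝒜 Unit) →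
      List (Letter 𝒵 Unit) → List (Letter 𝒜 μ) → A
  | [], _, _, w, [], as => D.toFun L₀ (w ++ as.map (Letter.relabel ()))
  | [], _, _, _, _ :: _, _ => 0
  | E :: S, ζ, α, w, zs, as =>
      unshuffleSum (fun L R =>
        cutSum (fun I J =>
          cutSum (fun K T =>
            ((α + wt I) * (E.deg + wt L) + ζ * E.deg).negOnePow •
              plug D L₀ S (ζ + wt L) (α + wt I + wt K)
                (w ++ I.map (Letter.relabel ()) ++
                  [⟨E.deg + wt L + wt K, E.toFun L K, E.mem L K, ()⟩]) R T)
            J) as) zs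

section lemmas

variable {M : Type*} [AddCommGroup M] [Module 𝕜 M]

@[simp] lemma wt_nil : wt ([] : List (Letter 𝒜 μ)) = 0 := rfl

@[simp] lemma wt_cons (a : Letter 𝒜 μ) (as : List (Letter 𝒜 μ)) :
    wt (a :: as) = a.deg + wt as := by simp [wt]

@[simp] lemma wt_append (as bs : List (Letter 𝒜 μ)) : wt (as ++ bs) = wt as + wt bs := by
  simp [wt]

@[simp] lemma wt_relabel {ν : Type} (m : ν) (as : List (Letter 𝒜 μ)) :
    wt (as.map (Letter.relabel m)) = wt as := by
  simp [wt, Function.comp_def, Letter.relabel]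

lemma isLinear_add {N : Type*} [AddCommGroup N] [Module 𝕜 N] {f g : N → M}
    (hf : IsLinearMap 𝕜 f) (hg : IsLinearMap 𝕜 g) : IsLinearMap 𝕜 (fun x => f x + g x) :=
  (hf.mk' f + hg.mk' g).isLinear

lemma isLinear_sign {N : Type*} [AddCommGroup N] [Module 𝕜 N] {f : N → M} (n : ℤˣ)
    (hf : IsLinearMap 𝕜 f) : IsLinearMap 𝕜 (fun x => n • f x) := by
  simp only [Units.smul_def]
  exact ((n : ℤ) • hf.mk' f).isLinear

lemma isLinear_comp {N P : Type*} [AddCommGroup N] [Module 𝕜 N] [AddCommGroup P] [Module 𝕜 P]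
    {f : P → M} {g : N → P} (hf : IsLinearMap 𝕜 f) (hg : IsLinearMap 𝕜 g) :
    IsLinearMap 𝕜 (fun x => f (g x)) :=
  ((hf.mk' f).comp (hg.mk' g)).isLinear

lemma isLinear_sum {N ι : Type*} [AddCommGroup N] [Module 𝕜 N] (s : Finset ι) {f : ι → N → M}
    (hf : ∀ i ∈ s, IsLinearMap 𝕜 (f i)) : IsLinearMap 𝕜 (fun x => ∑ i ∈ s, f i x) := by
  refine ⟨fun x y => ?_, fun c x => ?_⟩
  · rw [← Finset.sum_add_distrib]
    exact Finset.sum_congr rfl fun i hi => (hf i hi).map_add x y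
  · rw [Finset.smul_sum]
    exact Finset.sum_congr rfl fun i hi => (hf i hi).map_smul c x

lemma isLinear_zero {N : Type*} [AddCommGroup N] [Module 𝕜 N] :
    IsLinearMap 𝕜 (fun _ : N => (0 : M)) := (0 : N →ₗ[𝕜] M).isLinear

lemma cutSum_cons {α : Type*} (f : List α → List α → M) (a : α) (as : List α) :
    cutSum f (a :: as) = f [] (a :: as) + cutSum (fun u v => f (a :: u) v) as := by
  unfold cutSum
  rw [List.length_cons, Finset.sum_range_succ', add_comm]
  simp

lemma cutSum_mem {α : Type*} (p : Submodule 𝕜 M) {f : List α → List α → M} {as : List α}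
    (h : ∀ u v, u ++ v = as → f u v ∈ p) : cutSum f as ∈ p :=
  Submodule.sum_mem _ fun r _ => h _ _ (List.take_append_drop r as)

lemma cutSum_smul {α : Type*} (n : ℤˣ) {f : List α → List α → M} {as : List α} :
    cutSum (fun u v => n • f u v) as = n • cutSum f as := by
  simp only [cutSum, Finset.smul_sum]

lemma cutSum_linear {f : List (Letter 𝒜 μ) → List (Letter 𝒜 μ) → M} (d : ℤ) (m : μ)
    (hl : ∀ l r v, IsLinearMap 𝕜 (fun x : 𝒜 d => f (l ++ ⟨d, x.1, x.2, m⟩ :: r) v))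
    (hr : ∀ u l r, IsLinearMap 𝕜 (fun x : 𝒜 d => f u (l ++ ⟨d, x.1, x.2, m⟩ :: r)))
    (l r : List (Letter 𝒜 μ)) :
    IsLinearMap 𝕜 (fun x : 𝒜 d => cutSum f (l ++ ⟨d, x.1, x.2, m⟩ :: r)) := by
  induction l generalizing f with
  | nil =>
    simp only [List.nil_append, cutSum_cons]
    refine isLinear_add (by simpa using hr [] [] r) ?_
    unfold cutSum
    exact isLinear_sum _ fun i _ => by simpa using hl [] (r.take i) (r.drop i)
  | cons a l ih =>
    simp only [List.cons_append, cutSum_cons]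
    refine isLinear_add (by simpa using hr [] (a :: l) r) (ih (f := fun u v => f (a :: u) v) ?_ ?_)
    · intro l r v; simpa using hl (a :: l) r v
    · intro u l r; exact hr (a :: u) l r

lemma unshuffleSum_mem (p : Submodule 𝕜 M)
    {f : List (Letter 𝒵 Unit) → List (Letter 𝒵 Unit) → M} {zs : List (Letter 𝒵 Unit)}
    (h : ∀ L R, wt L + wt R = wt zs → f L R ∈ p) : unshuffleSum f zs ∈ p := by
  induction zs generalizing f with
  | nil => exact h _ _ (by simp)
  | cons z zs ih =>
    refine p.add_mem (ih fun L R e => h _ _ ?_) (ih fun L R e => ?_)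
    · simp only [wt_cons]; omega
    · rw [Units.smul_def]
      exact zsmul_mem (h _ _ (by simp only [wt_cons]; omega)) _

lemma unshuffleSum_linear_aux {N : Type*} [AddCommGroup N] [Module 𝕜 N]
    {f : N → List (Letter 𝒵 Unit) → List (Letter 𝒵 Unit) → M}
    (hf : ∀ L R, IsLinearMap 𝕜 (fun x => f x L R)) (zs : List (Letter 𝒵 Unit)) :
    IsLinearMap 𝕜 (fun x => unshuffleSum (f x) zs) := by
  induction zs generalizing f with
  | nil => exact hf _ _
  | cons z zs ih =>
    exact isLinear_add (ih (f := fun x L R => f x (z :: L) R) fun L R => hf _ _)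
      (ih (f := fun x L R => (z.deg * wt L).negOnePow • f x L (z :: R))
        fun L R => isLinear_sign _ (hf _ _))

lemma unshuffleSum_smul {M : Type*} [AddCommGroup M] (n : ℤˣ) (f : List (Letter 𝒵 Unit) → List (Letter 𝒵 Unit) → M)
    (zs : List (Letter 𝒵 Unit)) :
    unshuffleSum (fun L R => n • f L R) zs = n • unshuffleSum f zs := by
  induction zs generalizing f with
  | nil => rfl
  | cons z zs ih =>
    simp only [unshuffleSum, smul_add, ← ih]
    congr 2
    funext L R
    rw [smul_comm]

lemma unshuffleSum_linear {f : List (Letter 𝒵 Unit) → List (Letter 𝒵 Unit) → M} (d : ℤ)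
    (hl : ∀ l r R, IsLinearMap 𝕜 (fun x : 𝒵 d => f (l ++ ⟨d, x.1, x.2, ()⟩ :: r) R))
    (hr : ∀ L l r, IsLinearMap 𝕜 (fun x : 𝒵 d => f L (l ++ ⟨d, x.1, x.2, ()⟩ :: r)))
    (l r : List (Letter 𝒵 Unit)) :
    IsLinearMap 𝕜 (fun x : 𝒵 d => unshuffleSum f (l ++ ⟨d, x.1, x.2, ()⟩ :: r)) := by
  induction l generalizing f with
  | nil =>
    simp only [List.nil_append, unshuffleSum]
    refine isLinear_add (unshuffleSum_linear_aux
        (f := fun (x : 𝒵 d) L R => f (⟨d, x.1, x.2, ()⟩ :: L) R) (fun L R => ?_) r)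
      (unshuffleSum_linear_aux
        (f := fun (x : 𝒵 d) L R => (d * wt L).negOnePow • f L (⟨d, x.1, x.2, ()⟩ :: R))
        (fun L R => ?_) r)
    · simpa using hl [] L R
    · exact isLinear_sign _ (by simpa using hr L [] R)
  | cons z l ih =>
    simp only [List.cons_append, unshuffleSum]
    refine isLinear_add (ih (f := fun L R => f (z :: L) R) ?_ ?_)
      (ih (f := fun L R => (z.deg * wt L).negOnePow • f L (z :: R)) ?_ ?_)
    · intro l r R; exact hl (z :: l) r R
    · intro L l r; exact hr (z :: L) l r
    · intro l r R
      simp only [wt_append, wt_cons]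
      exact isLinear_sign _ (hl l r (z :: R))
    · intro L l r; exact isLinear_sign _ (hr L (z :: l) r)

lemma unshuffleSum_congr {M : Type*} [AddCommGroup M]
    {f g : List (Letter 𝒵 Unit) → List (Letter 𝒵 Unit) → M}
    (h : ∀ L R, f L R = g L R) (zs : List (Letter 𝒵 Unit)) :
    unshuffleSum f zs = unshuffleSum g zs := by
  have : f = g := funext fun L => funext fun R => h L R
  rw [this]

lemma unshuffleSum_symm {M : Type*} [AddCommGroup M]
    {f : List (Letter 𝒵 Unit) → List (Letter 𝒵 Unit) → M}
    (x y : Letter 𝒵 Unit)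
    (hl : ∀ l r R, f (l ++ x :: y :: r) R
      = (x.deg * y.deg).negOnePow • f (l ++ y :: x :: r) R)
    (hr : ∀ L l r, f L (l ++ x :: y :: r)
      = (x.deg * y.deg).negOnePow • f L (l ++ y :: x :: r))
    (l r : List (Letter 𝒵 Unit)) :
    unshuffleSum f (l ++ x :: y :: r)
      = (x.deg * y.deg).negOnePow • unshuffleSum f (l ++ y :: x :: r) := by
  induction l generalizing f with
  | nil =>
    simp only [List.nil_append, unshuffleSum, smul_add, ← unshuffleSum_smul]
    have e1 : ∀ L R, f (x :: y :: L) R = (x.deg * y.deg).negOnePow • f (y :: x :: L) R :=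
      fun L R => hl [] L R
    have e2 : ∀ L R, f L (x :: y :: R) = (x.deg * y.deg).negOnePow • f L (y :: x :: R) :=
      fun L R => hr L [] R
    have k (n : ℤ) : n.negOnePow * n.negOnePow = 1 := by simp
    have c1 := unshuffleSum_congr (f := fun L R => f (x :: y :: L) R)
      (g := fun L R => (x.deg * y.deg).negOnePow • f (y :: x :: L) R) e1 r
    have c2 := unshuffleSum_congr
      (f := fun L R => (y.deg * wt L).negOnePow • f (x :: L) (y :: R))
      (g := fun L R => (x.deg * y.deg).negOnePow •
        (y.deg * wt (x :: L)).negOnePow • f (x :: L) (y :: R)) (by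
        intro L R
        rw [smul_smul, wt_cons, mul_add, Int.negOnePow_add, ← mul_assoc, mul_comm y.deg x.deg, k,
          one_mul]) r
    have c3 := unshuffleSum_congr
      (f := fun L R => (x.deg * wt (y :: L)).negOnePow • f (y :: L) (x :: R))
      (g := fun L R => (x.deg * y.deg).negOnePow •
        (x.deg * wt L).negOnePow • f (y :: L) (x :: R)) (by
        intro L R
        rw [smul_smul, wt_cons, mul_add, Int.negOnePow_add]) r
    have c4 := unshuffleSum_congr
      (f := fun L R => (y.deg * wt L).negOnePow • (x.deg * wt L).negOnePow • f L (x :: y :: R))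
      (g := fun L R => (x.deg * y.deg).negOnePow •
        (x.deg * wt L).negOnePow • (y.deg * wt L).negOnePow • f L (y :: x :: R)) (by
        intro L R
        rw [e2]
        simp only [smul_smul]
        congr 1
        ac_rfl) r
    rw [c1, c2, c3, c4]
    abel
  | cons z l ih =>
    simp only [List.cons_append, unshuffleSum, smul_add]
    congr 1
    · exact ih (f := fun L R => f (z :: L) R) (fun l r R => hl (z :: l) r R)
        (fun L l r => hr (z :: L) l r)
    · refine ih (f := fun L R => (z.deg * wt L).negOnePow • f L (z :: R)) ?_ ?_
      · intro l r R
        rw [hl l r (z :: R), smul_comm]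
        congr 3
        simp only [wt_append, wt_cons]
        ring
      · intro L l r
        rw [← List.cons_append, hr L (z :: l) r, smul_comm]
        rfl

lemma plug_lin_word (D : Cochain 𝒵 𝒜) (L₀ : List (Letter 𝒵 Unit)) (S : List (Op 𝒵 𝒜 μ)) (ζ α : ℤ)
    (l r : List (Letter 𝒜 Unit)) (zs : List (Letter 𝒵 Unit)) (as : List (Letter 𝒜 μ)) (d : ℤ) :
    IsLinearMap 𝕜 (fun x : 𝒜 d => plug D L₀ S ζ α (l ++ ⟨d, x.1, x.2, ()⟩ :: r) zs as) := by
  induction S generalizing ζ α l r zs as with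
  | nil =>
    cases zs with
    | nil => simpa only [plug, List.append_assoc, List.cons_append] using D.lin_right _ _ _ d ()
    | cons z zs => simpa only [plug] using isLinear_zero
  | cons E S ih =>
    simp only [plug, List.append_assoc, List.cons_append, cutSum]
    refine unshuffleSum_linear_aux (f := fun (x : 𝒜 d) L R => _) (fun L R => ?_) zs
    exact isLinear_sum _ fun i _ => isLinear_sum _ fun j _ => isLinear_sign _ (ih _ _ _ _ _ _)

/-- Linearity in a letter that depends linearly on a parameter. -/
lemma plug_lin_comp (D : Cochain 𝒵 𝒜) (L₀ : List (Letter 𝒵 Unit)) (S : List (Op 𝒵 𝒜 μ)) (ζ α : ℤ)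
    (w : List (Letter 𝒜 Unit)) (zs : List (Letter 𝒵 Unit)) (as : List (Letter 𝒜 μ))
    {N : Type*} [AddCommGroup N] [Module 𝕜 N] {g : N → A} (hg : IsLinearMap 𝕜 g) (d : ℤ)
    (e : N → ℤ) (he : ∀ x, e x = d) (hm : ∀ x, g x ∈ 𝒜 (e x)) :
    IsLinearMap 𝕜 (fun x => plug D L₀ S ζ α (w ++ [⟨e x, g x, hm x, ()⟩]) zs as) := by
  obtain rfl : e = fun _ => d := funext he
  have := isLinear_comp (plug_lin_word D L₀ S ζ α w [] zs as d)
    (g := fun x => (⟨g x, hm x⟩ : 𝒜 d))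
    ⟨fun x y => Subtype.ext (hg.map_add x y), fun c x => Subtype.ext (hg.map_smul c x)⟩
  exact this

lemma plug_lin_right (D : Cochain 𝒵 𝒜) (L₀ : List (Letter 𝒵 Unit)) (S : List (Op 𝒵 𝒜 μ))
    (ζ α : ℤ) (w : List (Letter 𝒜 Unit)) (zs : List (Letter 𝒵 Unit)) (l r : List (Letter 𝒜 μ))
    (d : ℤ) (m : μ) :
    IsLinearMap 𝕜 (fun x : 𝒜 d => plug D L₀ S ζ α w zs (l ++ ⟨d, x.1, x.2, m⟩ :: r)) := by
  induction S generalizing ζ α w zs l r with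
  | nil =>
    cases zs with
    | nil =>
      simp only [plug, List.map_append, List.map_cons, Letter.relabel, ← List.append_assoc]
      exact D.lin_right _ _ _ d ()
    | cons z zs => simpa only [plug] using isLinear_zero
  | cons E S ih =>
    simp only [plug]
    refine unshuffleSum_linear_aux (f := fun (x : 𝒜 d) L R => _) (fun L R => ?_) zs
    refine cutSum_linear d m (fun l r J => ?_) (fun I l r => ?_) l r
    · unfold cutSum
      refine isLinear_sum _ fun j _ => ?_
      simp only [wt_append, wt_cons, List.map_append, List.map_cons, Letter.relabel,
        List.append_assoc, List.cons_append]
      refine isLinear_sign _ ?_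
      have := plug_lin_word D L₀ S (ζ + wt L) (α + (wt l + (d + wt r)) + wt (J.take j))
        (w ++ l.map (Letter.relabel ())) (r.map (Letter.relabel ()) ++
          [⟨E.deg + wt L + wt (J.take j), E.toFun L (J.take j), E.mem L (J.take j), ()⟩]) R
        (J.drop j) d
      simpa only [List.append_assoc, List.cons_append] using this
    · refine cutSum_linear d m (fun l r T => ?_) (fun K l r => ?_) l r
      · simp only [wt_append, wt_cons]
        refine isLinear_sign _ ?_
        exact plug_lin_comp D L₀ S _ _ _ _ _ (E.lin_right L l r d m)
          (E.deg + wt L + (wt l + (d + wt r))) _ (fun x => by simp) _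
      · exact isLinear_sign _ (ih _ _ _ _ _ _)

lemma plug_lin_left (D : Cochain 𝒵 𝒜) (L₀ : List (Letter 𝒵 Unit)) (S : List (Op 𝒵 𝒜 μ))
    (ζ α : ℤ) (w : List (Letter 𝒜 Unit)) (l r : List (Letter 𝒵 Unit)) (as : List (Letter 𝒜 μ))
    (d : ℤ) :
    IsLinearMap 𝕜 (fun x : 𝒵 d => plug D L₀ S ζ α w (l ++ ⟨d, x.1, x.2, ()⟩ :: r) as) := by
  induction S generalizing ζ α w l r as with
  | nil =>
    cases l with
    | nil => simpa only [plug, List.nil_append] using isLinear_zero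
    | cons z zs => simpa only [plug, List.cons_append] using isLinear_zero
  | cons E S ih =>
    simp only [plug]
    refine unshuffleSum_linear d (fun l r R => ?_) (fun L l r => ?_) l r
    · unfold cutSum
      refine isLinear_sum _ fun i _ => isLinear_sum _ fun j _ => ?_
      simp only [wt_append, wt_cons]
      refine isLinear_sign _ ?_
      exact plug_lin_comp D L₀ S _ _ _ _ _ (E.lin_left l r _ d)
          (E.deg + (wt l + (d + wt r)) + wt (((as.drop i)).take j)) _ (fun x => by simp) _
    · unfold cutSum
      exact isLinear_sum _ fun i _ => isLinear_sum _ fun j _ => isLinear_sign _ (ih _ _ _ _ _ _)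

lemma plug_lin_outer (D : Cochain 𝒵 𝒜) (l r : List (Letter 𝒵 Unit)) (S : List (Op 𝒵 𝒜 μ))
    (ζ α : ℤ) (w : List (Letter 𝒜 Unit)) (zs : List (Letter 𝒵 Unit)) (as : List (Letter 𝒜 μ))
    (d : ℤ) :
    IsLinearMap 𝕜 (fun x : 𝒵 d => plug D (l ++ ⟨d, x.1, x.2, ()⟩ :: r) S ζ α w zs as) := by
  induction S generalizing ζ α w zs as with
  | nil =>
    cases zs with
    | nil => simpa only [plug] using D.lin_left l r _ d
    | cons z zs => simpa only [plug] using isLinear_zero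
  | cons E S ih =>
    simp only [plug, cutSum]
    refine unshuffleSum_linear_aux (f := fun (x : 𝒵 d) L R => _) (fun L R => ?_) zs
    exact isLinear_sum _ fun i _ => isLinear_sum _ fun j _ => isLinear_sign _ (ih _ _ _ _ _)

lemma plug_word_sign (D : Cochain 𝒵 𝒜) (L₀ : List (Letter 𝒵 Unit)) (S : List (Op 𝒵 𝒜 μ))
    (ζ α : ℤ) (w : List (Letter 𝒜 Unit)) (zs : List (Letter 𝒵 Unit)) (as : List (Letter 𝒜 μ))
    (n : ℤˣ) (x y : Letter 𝒜 Unit) (hd : x.deg = y.deg) (hv : x.val = n • y.val) :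
    plug D L₀ S ζ α (w ++ [x]) zs as = n • plug D L₀ S ζ α (w ++ [y]) zs as := by
  revert hd hv
  obtain ⟨d, x, hx, -⟩ := x
  obtain ⟨d', y, hy, -⟩ := y
  intro hd hv
  obtain rfl : d = d' := hd
  obtain rfl : x = n • y := hv
  exact map_zsmul ((plug_lin_word D L₀ S ζ α w [] zs as d).mk' _) (n : ℤ) ⟨y, hy⟩

lemma plug_symm (D : Cochain 𝒵 𝒜) (L₀ : List (Letter 𝒵 Unit)) (S : List (Op 𝒵 𝒜 μ))
    (ζ α : ℤ) (w : List (Letter 𝒜 Unit)) (l r : List (Letter 𝒵 Unit)) (x y : Letter 𝒵 Unit)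
    (as : List (Letter 𝒜 μ)) :
    plug D L₀ S ζ α w (l ++ x :: y :: r) as
      = (x.deg * y.deg).negOnePow • plug D L₀ S ζ α w (l ++ y :: x :: r) as := by
  induction S generalizing ζ α w l r as with
  | nil => cases l <;> simp [plug]
  | cons E S ih =>
    simp only [plug]
    refine unshuffleSum_symm x y (fun l r R => ?_) (fun L l r => ?_) l r
    · simp only [← cutSum_smul]
      refine Finset.sum_congr rfl fun i _ => Finset.sum_congr rfl fun j _ => ?_
      beta_reduce
      rw [smul_comm]
      have e : wt (l ++ x :: y :: r) = wt (l ++ y :: x :: r) := by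
        simp only [wt_append, wt_cons]; ring
      simp only [e]
      congr 1
      exact plug_word_sign _ _ _ _ _ _ _ _ _ _ _ rfl (E.symm _ _ _ _ _)
    · simp only [← cutSum_smul]
      refine Finset.sum_congr rfl fun i _ => Finset.sum_congr rfl fun j _ => ?_
      beta_reduce
      rw [smul_comm, ih]

lemma plug_symm_outer (D : Cochain 𝒵 𝒜) (l r : List (Letter 𝒵 Unit)) (x y : Letter 𝒵 Unit)
    (S : List (Op 𝒵 𝒜 μ)) (ζ α : ℤ) (w : List (Letter 𝒜 Unit)) (zs : List (Letter 𝒵 Unit))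
    (as : List (Letter 𝒜 μ)) :
    plug D (l ++ x :: y :: r) S ζ α w zs as
      = (x.deg * y.deg).negOnePow • plug D (l ++ y :: x :: r) S ζ α w zs as := by
  induction S generalizing ζ α w zs as with
  | nil =>
    cases zs with
    | nil => simpa only [plug] using D.symm l r x y _
    | cons z zs => simp [plug]
  | cons E S ih =>
    simp only [plug, ← unshuffleSum_smul, ← cutSum_smul]
    refine unshuffleSum_congr (fun L R => ?_) zs
    refine Finset.sum_congr rfl fun i _ => Finset.sum_congr rfl fun j _ => ?_
    beta_reduce
    rw [smul_comm, ih]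

lemma plug_mem (D : Cochain 𝒵 𝒜) (L₀ : List (Letter 𝒵 Unit)) (S : List (Op 𝒵 𝒜 μ))
    (ζ α : ℤ) (w : List (Letter 𝒜 Unit)) (zs : List (Letter 𝒵 Unit)) (as : List (Letter 𝒜 μ))
    (d : ℤ) (hd : d = D.deg + (S.map Op.deg).sum + wt L₀ + wt w + wt zs + wt as) :
    plug D L₀ S ζ α w zs as ∈ 𝒜 d := by
  induction S generalizing ζ α w zs as with
  | nil =>
    cases zs with
    | nil =>
      simp only [plug]
      have := D.mem L₀ (w ++ as.map (Letter.relabel ()))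
      convert this using 2
      rw [hd]
      simp only [List.map_nil, List.sum_nil, wt_nil, wt_append, wt_relabel]
      ring
    | cons z zs => simp [plug]
  | cons E S ih =>
    simp only [plug]
    refine unshuffleSum_mem _ fun L R hLR => cutSum_mem _ fun I J hIJ => cutSum_mem _ fun K T hKT => ?_
    rw [Units.smul_def]
    refine zsmul_mem (ih _ _ _ _ _ ?_) _
    rw [hd, ← hIJ, ← hKT, ← hLR]
    simp only [List.map_cons, List.sum_cons, wt_append, wt_relabel, wt_cons, wt_nil]
    ring

end lemmas

/-- The (open-closed) brace operation `D{E₁, …, E_m}`. -/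
def brace (D : Cochain 𝒵 𝒜) (S : List (Op 𝒵 𝒜 μ)) : Op 𝒵 𝒜 μ where
  deg := D.deg + (S.map Op.deg).sum
  toFun zs as := unshuffleSum (fun L₀ R => plug D L₀ S (wt L₀) 0 [] R as) zs
  mem zs as := unshuffleSum_mem _ fun L R h => plug_mem _ _ _ _ _ _ _ _ _ (by
    rw [← h]; simp only [wt_nil]; ring)
  nil := by
    cases S with
    | nil => simpa [unshuffleSum, plug] using D.nil
    | cons E S =>
      simp only [unshuffleSum, plug, cutSum, List.length_nil, zero_add, Finset.range_one,
        Finset.sum_singleton, List.take_nil, List.drop_nil]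
      have h := (plug_lin_word D [] S 0 0 [] [] [] [] E.deg).map_zero
      have e : (⟨E.deg + wt [] + wt [], E.toFun [] [], E.mem [] [], ()⟩ : Letter 𝒜 Unit)
          = ⟨E.deg, ((0 : 𝒜 E.deg) : A), (0 : 𝒜 E.deg).2, ()⟩ :=
        Letter.ext (by simp) E.nil rfl
      rw [e]
      simp only [wt_nil, add_zero, List.map_nil, List.append_nil, List.nil_append] at h ⊢
      rw [h, smul_zero]
  lin_left l r as d := by
    refine unshuffleSum_linear d (fun l r R => ?_) (fun L l r => plug_lin_left _ _ _ _ _ _ _ _ _ _) l r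
    simp only [wt_append, wt_cons]
    exact plug_lin_outer _ _ _ _ _ _ _ _ _ _
  lin_right zs l r d m :=
    unshuffleSum_linear_aux (f := fun (x : 𝒜 d) L R => _)
      (fun L R => plug_lin_right D L S _ _ _ _ l r d m) zs
  symm l r x y as := by
    refine unshuffleSum_symm x y (fun l r R => ?_) (fun L l r => plug_symm _ _ _ _ _ _ _ _ _ _ _) l r
    have e : wt (l ++ x :: y :: r) = wt (l ++ y :: x :: r) := by
      simp only [wt_append, wt_cons]; ring
    rw [e]
    exact plug_symm_outer _ _ _ _ _ _ _ _ _ _ _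

/-- A cochain, regarded as an operation on labelled words that ignores the labels. -/
def Op.lift (D : Cochain 𝒵 𝒜) (μ : Type) : Op 𝒵 𝒜 μ where
  deg := D.deg
  toFun zs as := D.toFun zs (as.map (Letter.relabel ()))
  mem zs as := by simpa using D.mem zs (as.map (Letter.relabel ()))
  nil := D.nil
  lin_left l r as d := D.lin_left l r _ d
  lin_right zs l r d m := by
    simpa [Letter.relabel] using D.lin_right zs (l.map (Letter.relabel ()))
      (r.map (Letter.relabel ())) d ()
  symm l r x y as := D.symm l r x y _

/-- The place-holder for the distinguished input `a₀` in a brace, that is, the symbol `Δ` in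
`D{E₁,…,E_s,Δ,E_{s+1},…,E_m}` and `◊` in `E{F₁,…,F_j,◊,F_{j+1},…,F_n}`: the operation of degree
`0` whose only input is `a₀` (the letter labelled `true`) and which returns `a₀`. -/
def anchor : Op 𝒵 𝒜 Bool where
  deg := 0
  toFun
    | [], [a] => if a.mark then a.val else 0
    | _, _ => 0
  mem zs as := by
    split
    · next a => split_ifs <;> simp [a.mem]
    · simp
  nil := rfl
  lin_left l r as d := by cases l <;> simpa using isLinear_zero
  lin_right zs l r d m := by
    match zs, l, r with
    | [], [], [] =>
      cases m
      · simpa using isLinear_zero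
      · simpa using (𝒜 d).subtype.isLinear
    | [], [], _ :: _ => simpa using isLinear_zero
    | [], [_], _ => simpa using isLinear_zero
    | [], _ :: _ :: _, _ => simpa using isLinear_zero
    | _ :: _, _, _ => simpa using isLinear_zero
  symm l r x y as := by cases l <;> simp

/-- A homogeneous bilinear form `ω` on `A = ⨁ A_d`, of degree `|ω|`, that is non-degenerate in the
sense that `a ↦ ω(a, ·)` identifies `A_d` with the dual of `A_{-d-|ω|}`. -/
structure NondegForm (𝒜 : ℤ → Submodule 𝕜 A) where
  form : A →ₗ[𝕜] A →ₗ[𝕜] 𝕜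
  deg : ℤ
  homogeneous : ∀ (d e : ℤ) (a b : A), a ∈ 𝒜 d → b ∈ 𝒜 e → d + e + deg ≠ 0 → form a b = 0
  nondegenerate : ∀ d e : ℤ, d + e + deg = 0 →
    Function.Bijective (form.domRestrict₁₂ (𝒜 d) (𝒜 e))

/-- If the graded pieces are finite-dimensional vector spaces, then the condition in `NondegForm`
holds for every bilinear form of degree `w` that is non-degenerate in the usual sense. -/
theorem bijective_of_nondegenerate {F : Type u} [Field F] {B : Type v} [AddCommGroup B] [Module F B]
    (ℬ : ℤ → Submodule F B) [DirectSum.Decomposition ℬ] [∀ d, FiniteDimensional F (ℬ d)]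
    (ω : B →ₗ[F] B →ₗ[F] F) (w : ℤ)
    (h : ∀ (d e : ℤ) (a b : B), a ∈ ℬ d → b ∈ ℬ e → d + e + w ≠ 0 → ω a b = 0)
    (hω : ω.Nondegenerate) (d e : ℤ) (hde : d + e + w = 0) :
    Function.Bijective (ω.domRestrict₁₂ (ℬ d) (ℬ e)) := by
  classical
  have key : ∀ f : B →ₗ[F] F, ∀ e : ℤ, (∀ e' ≠ e, ∀ b ∈ ℬ e', f b = 0) → (∀ b ∈ ℬ e, f b = 0) →
      f = 0 := by
    intro f e h1 h2
    ext b
    induction b using DirectSum.Decomposition.inductionOn ℬ with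
    | zero => simp
    | homogeneous m =>
      rename_i i
      by_cases hi : i = e
      · subst hi; simpa using h2 _ m.2
      · simpa using h1 _ hi _ m.2
    | add x y hx hy => simp_all
  have h1 : Function.Injective (ω.domRestrict₁₂ (ℬ d) (ℬ e)) := by
    rw [injective_iff_map_eq_zero]
    intro a ha
    refine Subtype.ext (hω.1 a.1 fun y => ?_)
    rw [key (ω a.1) e (fun e' he b hb => h d e' _ _ a.2 hb (by omega)) fun b hb => by
      exact LinearMap.congr_fun ha ⟨b, hb⟩]
    rfl
  have h2 : Function.Injective (ω.domRestrict₁₂ (ℬ d) (ℬ e)).flip := by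
    rw [injective_iff_map_eq_zero]
    intro a ha
    refine Subtype.ext (hω.2 a.1 fun y => ?_)
    have := key (ω.flip a.1) d (fun e' he b hb => h e' e _ _ hb a.2 (by omega)) fun b hb => by
      exact LinearMap.congr_fun ha ⟨b, hb⟩
    exact LinearMap.congr_fun this y
  exact (LinearMap.IsPerfPair.of_injective h1 h2).bijective_left

/-- The scalar `∑_r (-1)^{|a_{[1,r]}| (|a_{[r+1,k]}| + |a₀|)} ω(G(z; a_{r+1},…,a_k,a₀,a₁,…,a_r), 𝟙)`,
where `a₀` is the labelled letter. -/
def cyclicSum (ω : NondegForm 𝒜) (one : 𝒜 (-1)) (G : Op 𝒵 𝒜 Bool)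
    (zs : List (Letter 𝒵 Unit)) (as : List (Letter 𝒜 Unit)) (a₀ : Letter 𝒜 Unit) : 𝕜 :=
  cutSum (fun v u => (wt v * (wt u + a₀.deg)).negOnePow •
    ω.form (G.toFun zs (u.map (Letter.relabel false) ++
      a₀.relabel true :: v.map (Letter.relabel false))) one) as

lemma cyclicSum_linear (ω : NondegForm 𝒜) (one : 𝒜 (-1)) (G : Op 𝒵 𝒜 Bool)
    (zs : List (Letter 𝒵 Unit)) (as : List (Letter 𝒜 Unit)) (d : ℤ) :
    IsLinearMap 𝕜 (fun x : 𝒜 d => cyclicSum ω one G zs as ⟨d, x.1, x.2, ()⟩) := by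
  unfold cyclicSum cutSum
  refine isLinear_sum _ fun i _ => ?_
  simp only [Letter.relabel]
  exact isLinear_sign _
    (isLinear_comp (ω.form.flip one.1).isLinear (G.lin_right _ _ _ d true))

/-- The degree of the cyclization of `G`, evaluated on the given inputs. -/
abbrev cycDeg (G : Op 𝒵 𝒜 Bool) (zs : List (Letter 𝒵 Unit)) (as : List (Letter 𝒜 Unit)) : ℤ :=
  G.deg - 1 + wt zs + wt as

/-- The element `x` of `A` with `ω(x, a₀) = cyclicSum ω one G zs as a₀` for all `a₀`. -/
def cycVal (ω : NondegForm 𝒜) (one : 𝒜 (-1)) (G : Op 𝒵 𝒜 Bool)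
    (zs : List (Letter 𝒵 Unit)) (as : List (Letter 𝒜 Unit)) : 𝒜 (cycDeg G zs as) :=
  (Equiv.ofBijective _ (ω.nondegenerate (cycDeg G zs as) (-cycDeg G zs as - ω.deg) (by ring))).symm
    (cyclicSum_linear ω one G zs as (-cycDeg G zs as - ω.deg)).mk'

/-- The defining property of `cycVal`, for homogeneous `a₀` of arbitrary degree. -/
theorem form_cycVal (ω : NondegForm 𝒜) (one : 𝒜 (-1)) (G : Op 𝒵 𝒜 Bool)
    (zs : List (Letter 𝒵 Unit)) (as : List (Letter 𝒜 Unit)) (a₀ : Letter 𝒜 Unit) :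
    ω.form (cycVal ω one G zs as) a₀.val = cyclicSum ω one G zs as a₀ := by
  obtain ⟨e, a, ha, -⟩ := a₀
  by_cases h : e = -cycDeg G zs as - ω.deg
  · subst h
    have := LinearMap.congr_fun (Equiv.ofBijective_apply_symm_apply _ (ω.nondegenerate
      (cycDeg G zs as) (-cycDeg G zs as - ω.deg) (by ring))
      (cyclicSum_linear ω one G zs as (-cycDeg G zs as - ω.deg)).mk') ⟨a, ha⟩
    exact this
  · rw [ω.homogeneous _ e _ a (cycVal ω one G zs as).2 ha (by omega)]
    symm
    unfold cyclicSum cutSum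
    refine Finset.sum_eq_zero fun r _ => ?_
    beta_reduce
    rw [ω.homogeneous _ (-1) _ _ (G.mem _ _) one.2, smul_zero]
    have hw : wt as = wt (as.take r) + wt (as.drop r) := by
      rw [← wt_append, List.take_append_drop]
    simp only [wt_append, wt_relabel, wt_cons, Letter.relabel]
    simp only [cycDeg] at h
    omega

lemma eq_cycVal (ω : NondegForm 𝒜) (one : 𝒜 (-1)) (G : Op 𝒵 𝒜 Bool)
    (zs : List (Letter 𝒵 Unit)) (as : List (Letter 𝒜 Unit)) (x : A) (d : ℤ) (hx : x ∈ 𝒜 d)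
    (hd : d = cycDeg G zs as)
    (h : ∀ a₀ : Letter 𝒜 Unit, ω.form x a₀.val = cyclicSum ω one G zs as a₀) :
    x = cycVal ω one G zs as := by
  subst hd
  have := (ω.nondegenerate (cycDeg G zs as) (-cycDeg G zs as - ω.deg) (by ring)).1
    (a₁ := ⟨x, hx⟩) (a₂ := cycVal ω one G zs as) (LinearMap.ext fun a => by
      have h1 := h ⟨_, a.1, a.2, ()⟩
      rw [← form_cycVal] at h1
      exact h1)
  exact congrArg Subtype.val this

lemma cycVal_linear (ω : NondegForm 𝒜) (one : 𝒜 (-1)) (G : Op 𝒵 𝒜 Bool)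
    {N : Type*} [AddCommGroup N] [Module 𝕜 N] (zs : N → List (Letter 𝒵 Unit))
    (as : N → List (Letter 𝒜 Unit)) (d : ℤ) (hd : ∀ x, cycDeg G (zs x) (as x) = d)
    (h : ∀ a₀, IsLinearMap 𝕜 (fun x => cyclicSum ω one G (zs x) (as x) a₀)) :
    IsLinearMap 𝕜 (fun x => (cycVal ω one G (zs x) (as x) : A)) := by
  have hm : ∀ x, (cycVal ω one G (zs x) (as x) : A) ∈ 𝒜 d := fun x => by
    rw [← hd x]; exact (cycVal ω one G (zs x) (as x)).2
  refine ⟨fun x y => ?_, fun c x => ?_⟩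
  · refine (eq_cycVal ω one G _ _ _ d ((𝒜 d).add_mem (hm x) (hm y)) (hd _).symm fun a₀ => ?_).symm
    rw [map_add, LinearMap.add_apply, form_cycVal, form_cycVal, (h a₀).map_add]
  · refine (eq_cycVal ω one G _ _ _ d ((𝒜 d).smul_mem c (hm x)) (hd _).symm fun a₀ => ?_).symm
    rw [map_smul, LinearMap.smul_apply, form_cycVal, (h a₀).map_smul]

lemma cyclicSum_lin_left (ω : NondegForm 𝒜) (one : 𝒜 (-1)) (G : Op 𝒵 𝒜 Bool)
    (l r : List (Letter 𝒵 Unit)) (as : List (Letter 𝒜 Unit)) (d : ℤ) (a₀ : Letter 𝒜 Unit) :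
    IsLinearMap 𝕜 (fun x : 𝒵 d => cyclicSum ω one G (l ++ ⟨d, x.1, x.2, ()⟩ :: r) as a₀) := by
  unfold cyclicSum cutSum
  exact isLinear_sum _ fun i _ => isLinear_sign _
    (isLinear_comp (ω.form.flip one.1).isLinear (G.lin_left l r _ d))

lemma cyclicSum_lin_right (ω : NondegForm 𝒜) (one : 𝒜 (-1)) (G : Op 𝒵 𝒜 Bool)
    (zs : List (Letter 𝒵 Unit)) (l r : List (Letter 𝒜 Unit)) (d : ℤ) (a₀ : Letter 𝒜 Unit) :
    IsLinearMap 𝕜 (fun x : 𝒜 d => cyclicSum ω one G zs (l ++ ⟨d, x.1, x.2, ()⟩ :: r) a₀) := by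
  unfold cyclicSum
  refine cutSum_linear d () (fun l r v => ?_) (fun u l r => ?_) l r
  · simp only [wt_append, wt_cons, List.map_append, List.map_cons, Letter.relabel]
    refine isLinear_sign _ (isLinear_comp (ω.form.flip one.1).isLinear ?_)
    have := G.lin_right zs (v.map (Letter.relabel false) ++ ⟨a₀.deg, a₀.val, a₀.mem, true⟩ ::
      l.map (Letter.relabel false)) (r.map (Letter.relabel false)) d false
    simpa [Letter.relabel] using this
  · simp only [wt_append, wt_cons, List.map_append, List.map_cons, Letter.relabel]
    refine isLinear_sign _ (isLinear_comp (ω.form.flip one.1).isLinear ?_)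
    have := G.lin_right zs (l.map (Letter.relabel false)) (r.map (Letter.relabel false) ++
      ⟨a₀.deg, a₀.val, a₀.mem, true⟩ :: u.map (Letter.relabel false)) d false
    simpa [Letter.relabel] using this

lemma cyclicSum_symm (ω : NondegForm 𝒜) (one : 𝒜 (-1)) (G : Op 𝒵 𝒜 Bool)
    (l r : List (Letter 𝒵 Unit)) (x y : Letter 𝒵 Unit) (as : List (Letter 𝒜 Unit))
    (a₀ : Letter 𝒜 Unit) :
    cyclicSum ω one G (l ++ x :: y :: r) as a₀
      = (x.deg * y.deg).negOnePow • cyclicSum ω one G (l ++ y :: x :: r) as a₀ := by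
  unfold cyclicSum
  rw [← cutSum_smul]
  refine Finset.sum_congr rfl fun i _ => ?_
  beta_reduce
  rw [G.symm, smul_comm]
  congr 1
  simp only [Units.smul_def, map_zsmul, LinearMap.smul_apply]

/-- The cyclization of `G`: the cochain with
`ω(cyc(G)(z_{[ℓ]}; a_{[k]}), a₀) = ∑_r ± ω(G(z_{[ℓ]}; a_{r+1},…,a_k,a₀,a₁,…,a_r), 𝟙)` for
`(ℓ,k) ≠ (0,0)`. -/
def cyc (ω : NondegForm 𝒜) (one : 𝒜 (-1)) (G : Op 𝒵 𝒜 Bool) : Cochain 𝒵 𝒜 where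
  deg := G.deg - 1
  toFun
    | [], [] => 0
    | zs, as => cycVal ω one G zs as
  mem zs as := by
    split
    · exact Submodule.zero_mem _
    · exact (cycVal ω one G zs as).2
  nil := rfl
  lin_left l r as d := by
    have := cycVal_linear ω one G (fun x : 𝒵 d => l ++ ⟨d, x.1, x.2, ()⟩ :: r) (fun _ => as)
      (G.deg - 1 + (wt l + (d + wt r)) + wt as) (fun x => by simp [cycDeg])
      (fun a₀ => cyclicSum_lin_left ω one G l r as d a₀)
    cases l <;> exact this
  lin_right zs l r d m := by
    have := cycVal_linear ω one G (fun _ => zs) (fun x : 𝒜 d => l ++ ⟨d, x.1, x.2, ()⟩ :: r)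
      (G.deg - 1 + wt zs + (wt l + (d + wt r))) (fun x => by simp [cycDeg])
      (fun a₀ => cyclicSum_lin_right ω one G zs l r d a₀)
    cases l <;> cases zs <;> exact this
  symm l r x y as := by
    have := eq_cycVal ω one G (l ++ x :: y :: r) as
      ((x.deg * y.deg).negOnePow • (cycVal ω one G (l ++ y :: x :: r) as : A)) _
      (by rw [Units.smul_def]; exact zsmul_mem (cycVal ω one G (l ++ y :: x :: r) as).2 _)
      (by simp only [cycDeg, wt_append, wt_cons]; ring) (fun a₀ => by
        rw [cyclicSum_symm, ← form_cycVal]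
        simp only [Units.smul_def, map_zsmul, LinearMap.smul_apply])
    cases l <;> exact this.symm

/-- The list `E₁, …, E_s, Δ, E_{s+1}, …, E_m`, respectively with `◊` in place of `Δ`. -/
def anchored (S S' : List (Cochain 𝒵 𝒜)) : List (Op 𝒵 𝒜 Bool) :=
  S.map (fun E => E.lift Bool) ++ anchor :: S'.map (fun E => E.lift Bool)

/-- The first-order cyclic brace `D{E₁, …, E_s, Δ, E_{s+1}, …, E_m}`. -/
def brace₁ (ω : NondegForm 𝒜) (one : 𝒜 (-1)) (D : Cochain 𝒵 𝒜) (S S' : List (Cochain 𝒵 𝒜)) :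
    Cochain 𝒵 𝒜 :=
  cyc ω one (brace D (anchored S S'))

/-- The second-order cyclic brace
`D{E₁, …, E_{i-1}, E_i{F₁, …, F_j, ◊, F_{j+1}, …, F_n}, E_{i+1}, …, E_m}`, with
`S = [E₁, …, E_{i-1}]`, `E = E_i`, `T = [F₁, …, F_j]`, `T' = [F_{j+1}, …, F_n]`,
`S' = [E_{i+1}, …, E_m]`. -/
def brace₂ (ω : NondegForm 𝒜) (one : 𝒜 (-1)) (D : Cochain 𝒵 𝒜) (S : List (Cochain 𝒵 𝒜))
    (E : Cochain 𝒵 𝒜) (T T' : List (Cochain 𝒵 𝒜)) (S' : List (Cochain 𝒵 𝒜)) : Cochain 𝒵 𝒜 :=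
  cyc ω one (brace D (S.map (fun E => E.lift Bool) ++
    brace E (anchored T T') :: S'.map (fun E => E.lift Bool)))

/-- The segment `F_{a+1}, …, F_b`. -/
def seg {n : ℕ} (F : Fin n → Cochain 𝒵 𝒜) (a b : ℕ) : List (Cochain 𝒵 𝒜) :=
  ((List.ofFn F).take b).drop a

/-- `|F_{a+1}| + ⋯ + |F_b|`. -/
def segDeg {n : ℕ} (F : Fin n → Cochain 𝒵 𝒜) (a b : ℕ) : ℤ :=
  ((seg F a b).map Op.deg).sum

/-- The sequence `j₀ = r, j₁, …, j_s`. -/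
def ext₀ {n s : ℕ} (r : ℕ) (j : Fin s → Fin (n + 1)) : Fin (s + 1) → ℕ :=
  Fin.cons r (fun k => (j k : ℕ))

/-- All pairs of sequences of integers with `r ≤ i₁ ≤ j₁ ≤ i₂ ≤ j₂ ≤ ⋯ ≤ i_s ≤ j_s ≤ n`. -/
def interlaced (n r s : ℕ) : Finset ((Fin s → Fin (n + 1)) × (Fin s → Fin (n + 1))) :=
  Finset.univ.filter fun p => ∀ k : Fin s,
    ext₀ r p.2 k.castSucc ≤ (p.1 k : ℕ) ∧ (p.1 k : ℕ) ≤ (p.2 k : ℕ)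

/-- The list `F_{r+1}, …, F_{i₁}, E₁{F_{i₁+1}, …, F_{j₁}}, F_{j₁+1}, …, F_{i₂}, E₂{F_{i₂+1}, …, F_{j₂}},
…, F_{i_s}, E_s{F_{i_s+1}, …, F_{j_s}}`. -/
def weave {n s : ℕ} (r : ℕ) (E : Fin s → Cochain 𝒵 𝒜) (F : Fin n → Cochain 𝒵 𝒜)
    (i j : Fin s → Fin (n + 1)) : List (Cochain 𝒵 𝒜) :=
  (List.finRange s).flatMap fun k =>
    seg F (ext₀ r j k.castSucc) (i k) ++ [brace (E k) (seg F (i k) (j k))]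

/-- `∑_k |E_k| (|F_{r+1}| + ⋯ + |F_{i_k}|)`. -/
def weaveSign {n s : ℕ} (r : ℕ) (E : Fin s → Cochain 𝒵 𝒜) (F : Fin n → Cochain 𝒵 𝒜)
    (i : Fin s → Fin (n + 1)) : ℤ :=
  ∑ k, (E k).deg * segDeg F r (i k)

/-- The first `s` terms of a finite sequence. -/
def initial {m s : ℕ} (h : s ≤ m) (E : Fin m → Cochain 𝒵 𝒜) : Fin s → Cochain 𝒵 𝒜 :=
  fun k => E (Fin.castLE h k)

end CyclicBrace

end

noncomputable section

namespace CyclicBrace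

universe u v w

variable {𝕜 : Type u} [CommRing 𝕜]
variable {A : Type v} [AddCommGroup A] [Module 𝕜 A]
variable {Z : Type w} [AddCommGroup Z] [Module 𝕜 Z]
variable {𝒵 : ℤ → Submodule 𝕜 Z} {𝒜 : ℤ → Submodule 𝕜 A} {μ ν : Type}
variable {M N : Type*} [AddCommGroup M] [AddCommGroup N]

/-! ### Signs and formal sums -/

/-! Both relations rest on one fact about inserting operations into words. `insertSum S f` adds up
`f` over all words obtained from the inputs by letting the operations `S` act on consecutive blocks,
with the Koszul sign of the permutation involved. By `brace_toFun`, `D{S}` is this sum for `f =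
D(z_L; ·)`, summed over the `z`'s that `D` keeps.

Insert a list `E` into the words produced by a list `G`. Each `E_k` consumes a run of letters of the
intermediate word; the operations of `G` whose outputs lie in that run are absorbed into `E_k{…}`,
and the others stay between the `E`'s. Hence a composite of insertions is a sum over weaves
(`composeSum_eq_weaveSum`), which with `D` outermost is the ordinary brace relation `brace_brace`.
The induction works because insertion is compatible with cutting the produced word: a cut of the
word induces a cut of the list of operations (`insertSum_cutSum`).

The symbols `Δ` and `◊` are both realised by the operation `anchor`, so cyclic braces are
cyclizations `cyc` of ordinary braces on labelled words. For (i), the brace relation with inserted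
list `F₁, …, F_n, anchor` is cyclized term by term (`cyc_brace_brace`). Since the anchor comes last,
it is either a direct argument of `D`, or the last argument of some `E_s`; in both cases the later
`E`'s receive nothing. These alternatives are the two sums (`weaveSum_append_singleton`).

For (ii), the `F`'s are inserted into an already cyclized operation (`brace_brace₁`). Pairing with
`a₀` rotates the word they produce: it is cut as `v u` and becomes `u a₀ v`. The cut divides the
`F`'s into `F₁, …, F_r`, which produce `v`, and the rest, which produce `u`. The `E`'s all lie to
the left of `a₀`, so they weave only with `F_{r+1}, …, F_n`, while `F₁, …, F_r` end up after `Δ`;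
exchanging the two groups gives the sign `∑ |F_p||F_q|`. Non-degeneracy of `ω` then removes the
pairing. The component `(0,0)`, where the defining equation of a cyclic brace is not imposed, is
treated apart: everything vanishes there.

Comparing signs means comparing polynomials in the degrees modulo 2, which is often done by passing
to `ZMod 2` with `negOnePow_congr`. -/

lemma negOnePow_congr {a b : ℤ} (h : (a : ZMod 2) = b) : a.negOnePow = b.negOnePow := by
  rw [Int.negOnePow_eq_iff, even_iff_two_dvd]
  exact (ZMod.intCast_eq_intCast_iff_dvd_sub b a 2).1 h.symm

lemma map_negOnePow_smul (φ : M →+ N) (n : ℤˣ) (x : M) : φ (n • x) = n • φ x := by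
  simp only [Units.smul_def, map_zsmul]

/-- A functional on functions with values in `M` which is a formal `ℤ`-linear combination of
evaluations. -/
def IsFormalSum {ι : Type*} (Φ : (ι → M) → M) : Prop :=
  ∃ c : FreeAbelianGroup ι, ∀ f, Φ f = FreeAbelianGroup.lift f c

namespace IsFormalSum

variable {ι κ : Type*} {Φ : (ι → M) → M} {Ψ : (κ → M) → M}

lemma map_add (h : IsFormalSum Φ) (f g : ι → M) : Φ (fun i => f i + g i) = Φ f + Φ g := by
  obtain ⟨c, hc⟩ := h
  simp only [hc]
  exact FreeAbelianGroup.lift_add_apply f g c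

lemma map_zero (h : IsFormalSum Φ) : Φ (fun _ => 0) = 0 := by
  have := h.map_add (fun _ => 0) (fun _ => 0)
  simpa using this

lemma map_sum (h : IsFormalSum Φ) {α : Type*} (s : Finset α) (f : α → ι → M) :
    Φ (fun i => ∑ a ∈ s, f a i) = ∑ a ∈ s, Φ (f a) := by
  classical
  induction s using Finset.induction_on with
  | empty => simpa using h.map_zero
  | insert a s ha ih => simp only [Finset.sum_insert ha, h.map_add, ih]

lemma map_neg (h : IsFormalSum Φ) (f : ι → M) : Φ (fun i => -f i) = -Φ f := by
  have := h.map_add f (fun i => -f i)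
  simp only [add_neg_cancel, h.map_zero] at this
  exact (neg_eq_of_add_eq_zero_right this.symm).symm

lemma map_smul (h : IsFormalSum Φ) (n : ℤˣ) (f : ι → M) : Φ (fun i => n • f i) = n • Φ f := by
  rcases Int.units_eq_one_or n with rfl | rfl
  · simp
  · simpa using h.map_neg f

/-- For a single evaluation `Φ` both sides agree, and additivity of `Ψ` extends this to formal
combinations. This is the Fubini theorem for the recursively defined sums below, which are not given
as sums over index sets. -/
lemma swap (hΦ : IsFormalSum Φ) (hΨ : IsFormalSum Ψ) (f : ι → κ → M) :
    Φ (fun i => Ψ (f i)) = Ψ (fun k => Φ (fun i => f i k)) := by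
  obtain ⟨c, hc⟩ := hΦ
  simp only [hc]
  clear hc
  induction c using FreeAbelianGroup.induction_on with
  | zero => simpa using hΨ.map_zero.symm
  | of x => simp
  | neg x ih => simpa using hΨ.map_neg _ |>.symm
  | add x y hx hy => simp only [_root_.map_add, hx, hy, hΨ.map_add]

end IsFormalSum

/-! ### Sums over unshuffles -/

abbrev ZWord (𝒵 : ℤ → Submodule 𝕜 Z) := List (Letter 𝒵 Unit)

lemma map_unshuffleSum (φ : M →+ N) (f : ZWord 𝒵 → ZWord 𝒵 → M) (zs : ZWord 𝒵) :
    φ (unshuffleSum f zs) = unshuffleSum (fun L R => φ (f L R)) zs := by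
  induction zs generalizing f with
  | nil => rfl
  | cons z zs ih => simp only [unshuffleSum, map_add, ih, map_negOnePow_smul]

/-- The formal combination is the same sum taken for the universal function `FreeAbelianGroup.of`;
naturality under `lift f` recovers the sum for `f`. The other sums below are treated in the same
way. -/
lemma isFormalSum_unshuffleSum (zs : ZWord 𝒵) :
    IsFormalSum (fun f : ZWord 𝒵 × ZWord 𝒵 → M => unshuffleSum (fun L R => f (L, R)) zs) :=
  ⟨unshuffleSum (fun L R => FreeAbelianGroup.of (L, R)) zs, fun f => by
    simp [map_unshuffleSum]⟩

/-- The summands may be compared using what holds for every unshuffle. Additivity of weights serves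
to match signs; additivity of lengths serves in `brace_brace₁` to exclude an empty set of inputs. -/
lemma unshuffleSum_congr_of {f g : ZWord 𝒵 → ZWord 𝒵 → M} {zs : ZWord 𝒵}
    (h : ∀ L R, wt L + wt R = wt zs → L.length + R.length = zs.length → f L R = g L R) :
    unshuffleSum f zs = unshuffleSum g zs := by
  induction zs generalizing f g with
  | nil => exact h _ _ (by simp) (by simp)
  | cons z zs ih =>
    simp only [unshuffleSum]
    congr 1
    · refine ih fun L R h1 h2 => h _ _ ?_ ?_
      · simp only [wt_cons]; omega
      · simp only [List.length_cons]; omega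
    · refine ih fun L R h1 h2 => ?_
      rw [h]
      · simp only [wt_cons]; omega
      · simp only [List.length_cons]; omega

lemma unshuffleSum_add (f g : ZWord 𝒵 → ZWord 𝒵 → M) (zs : ZWord 𝒵) :
    unshuffleSum (fun L R => f L R + g L R) zs = unshuffleSum f zs + unshuffleSum g zs :=
  (isFormalSum_unshuffleSum zs).map_add (fun p => f p.1 p.2) (fun p => g p.1 p.2)

@[simp] lemma unshuffleSum_zero (zs : ZWord 𝒵) :
    unshuffleSum (fun _ _ => (0 : M)) zs = 0 :=
  (isFormalSum_unshuffleSum zs).map_zero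

lemma unshuffleSum_sum {α : Type*} (s : Finset α) (f : α → ZWord 𝒵 → ZWord 𝒵 → M)
    (zs : ZWord 𝒵) :
    unshuffleSum (fun L R => ∑ a ∈ s, f a L R) zs = ∑ a ∈ s, unshuffleSum (f a) zs :=
  (isFormalSum_unshuffleSum zs).map_sum s (fun a p => f a p.1 p.2)

lemma unshuffleSum_unshuffleSum_swap (f : ZWord 𝒵 → ZWord 𝒵 → ZWord 𝒵 → ZWord 𝒵 → M)
    (zs ys : ZWord 𝒵) :
    unshuffleSum (fun L R => unshuffleSum (fun L' R' => f L R L' R') ys) zs =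
      unshuffleSum (fun L' R' => unshuffleSum (fun L R => f L R L' R') zs) ys :=
  (isFormalSum_unshuffleSum zs).swap (isFormalSum_unshuffleSum ys)
    (fun p q => f p.1 p.2 q.1 q.2)

lemma unshuffleSum_nil_left {f : ZWord 𝒵 → ZWord 𝒵 → M} (h : ∀ z L R, f (z :: L) R = 0)
    (zs : ZWord 𝒵) : unshuffleSum f zs = f [] zs := by
  induction zs generalizing f with
  | nil => rfl
  | cons z zs ih =>
    simp only [unshuffleSum, h, unshuffleSum_zero, zero_add]
    rw [ih fun z L R => by rw [h, smul_zero]]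
    simp

/-- Graded cocommutativity of the unshuffle coproduct. -/
lemma unshuffleSum_comm (f : ZWord 𝒵 → ZWord 𝒵 → M) (zs : ZWord 𝒵) :
    unshuffleSum f zs = unshuffleSum (fun L R => (wt L * wt R).negOnePow • f R L) zs := by
  induction zs generalizing f with
  | nil => simp [unshuffleSum]
  | cons z zs ih =>
    simp only [unshuffleSum]
    rw [add_comm, ih (fun L R => f (z :: L) R), ih (fun L R => _ • f L (z :: R))]
    congr 1
    · refine unshuffleSum_congr (fun L R => ?_) zs
      rw [smul_smul, ← Int.negOnePow_add]
      congr 2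
      simp only [wt_cons]; ring
    · refine unshuffleSum_congr (fun L R => ?_) zs
      rw [smul_smul, ← Int.negOnePow_add]
      congr 1
      apply negOnePow_congr
      simp only [wt_cons]; push_cast; grind

lemma unshuffleSum_nil_right {f : ZWord 𝒵 → ZWord 𝒵 → M} (h : ∀ z L R, f L (z :: R) = 0)
    (zs : ZWord 𝒵) : unshuffleSum f zs = f zs [] := by
  rw [unshuffleSum_comm, unshuffleSum_nil_left fun z L R => by rw [h, smul_zero]]
  simp

/-- Coassociativity of the unshuffle coproduct: both sides run over partitions into three ordered
blocks. -/
lemma unshuffleSum_assoc (f : ZWord 𝒵 → ZWord 𝒵 → ZWord 𝒵 → M) (zs : ZWord 𝒵) :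
    unshuffleSum (fun L R => unshuffleSum (fun R₁ R₂ => f L R₁ R₂) R) zs =
      unshuffleSum (fun L R => unshuffleSum (fun L₁ L₂ => f L₁ L₂ R) L) zs := by
  induction zs generalizing f with
  | nil => rfl
  | cons z zs ih =>
    simp only [unshuffleSum, smul_add, unshuffleSum_add, ← unshuffleSum_smul]
    rw [ih (fun L R₁ R₂ => f (z :: L) R₁ R₂),
      ih (fun L R₁ R₂ => (z.deg * wt L).negOnePow • f L (z :: R₁) R₂),
      ih (fun L R₁ R₂ => (z.deg * wt L).negOnePow • (z.deg * wt R₁).negOnePow • f L R₁ (z :: R₂)),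
      add_assoc]
    congr 2
    refine unshuffleSum_congr (fun L R => unshuffleSum_congr_of fun L₁ L₂ h _ => ?_) zs
    rw [smul_smul, ← Int.negOnePow_add, ← h, mul_add]

/-- Both sides are sums over partitions into four blocks. Coassociativity makes the two middle
blocks `P₂` and `R₁` a partition of a single block, and cocommutativity exchanges them. -/
lemma unshuffleSum_interchange (f : ZWord 𝒵 → ZWord 𝒵 → ZWord 𝒵 → ZWord 𝒵 → M)
    (zs : ZWord 𝒵) :
    unshuffleSum (fun P R => unshuffleSum (fun P₁ P₂ => unshuffleSum (fun R₁ R₂ =>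
        f P₁ P₂ R₁ R₂) R) P) zs =
      unshuffleSum (fun L R => unshuffleSum (fun P₁ R₁ => unshuffleSum (fun P₂ R₂ =>
        (wt P₂ * wt R₁).negOnePow • f P₁ P₂ R₁ R₂) R) L) zs := by
  rw [← unshuffleSum_assoc (fun P₁ P₂ R => unshuffleSum (fun R₁ R₂ => f P₁ P₂ R₁ R₂) R),
    ← unshuffleSum_assoc (fun P₁ R₁ R => unshuffleSum (fun P₂ R₂ =>
        (wt P₂ * wt R₁).negOnePow • f P₁ P₂ R₁ R₂) R)]
  refine unshuffleSum_congr (fun P₁ Q => ?_) zs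
  rw [unshuffleSum_assoc (fun P₂ R₁ R₂ => f P₁ P₂ R₁ R₂),
    unshuffleSum_assoc (fun R₁ P₂ R₂ => (wt P₂ * wt R₁).negOnePow • f P₁ P₂ R₁ R₂)]
  refine unshuffleSum_congr (fun X R₂ => ?_) Q
  rw [unshuffleSum_comm]
  refine unshuffleSum_congr (fun R₁ P₂ => ?_) X
  rw [mul_comm]

/-! ### Sums over cuts -/

section cuts

variable {α β : Type*}

@[simp] lemma cutSum_nil (f : List α → List α → M) : cutSum f [] = f [] [] := by simp [cutSum]

lemma map_cutSum (φ : M →+ N) (f : List α → List α → M) (as : List α) :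
    φ (cutSum f as) = cutSum (fun u v => φ (f u v)) as := by
  simp only [cutSum, map_sum]

lemma cutSum_congr {f g : List α → List α → M} {as : List α}
    (h : ∀ u v, u ++ v = as → f u v = g u v) : cutSum f as = cutSum g as :=
  Finset.sum_congr rfl fun r _ => h _ _ (List.take_append_drop r as)

lemma cutSum_add (f g : List α → List α → M) (as : List α) :
    cutSum (fun u v => f u v + g u v) as = cutSum f as + cutSum g as := by
  simp only [cutSum, Finset.sum_add_distrib]

@[simp] lemma cutSum_zero (as : List α) : cutSum (fun _ _ => (0 : M)) as = 0 := by
  simp [cutSum]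

lemma cutSum_map (g : α → β) (f : List β → List β → M) (as : List α) :
    cutSum f (as.map g) = cutSum (fun u v => f (u.map g) (v.map g)) as := by
  simp [cutSum, List.map_take, List.map_drop]

/-- Coassociativity of deconcatenation. -/
lemma cutSum_assoc (f : List α → List α → List α → M) (as : List α) :
    cutSum (fun u v => cutSum (fun v₁ v₂ => f u v₁ v₂) v) as =
      cutSum (fun u v => cutSum (fun u₁ u₂ => f u₁ u₂ v) u) as := by
  induction as generalizing f with
  | nil => simp
  | cons a as ih =>
    simp only [cutSum_cons, cutSum_nil, cutSum_add]
    rw [ih (fun u v₁ v₂ => f (a :: u) v₁ v₂)]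
    abel

/-- A word that is the concatenation of `u` and `a :: v` is cut either inside `u` or after `a`. -/
lemma cutSum_append_cons (f : List α → List α → M) (u v : List α) (a : α) :
    cutSum f (u ++ a :: v) =
      cutSum (fun u₁ u₂ => f u₁ (u₂ ++ a :: v)) u + cutSum (fun v₁ v₂ => f (u ++ a :: v₁) v₂) v := by
  induction u generalizing f with
  | nil => simp [cutSum_cons]
  | cons b u ih => simp [cutSum_cons, ih, add_assoc]

lemma cutSum_append_singleton (f : List α → List α → M) (u : List α) (a : α) :
    cutSum f (u ++ [a]) = cutSum (fun u₁ u₂ => f u₁ (u₂ ++ [a])) u + f (u ++ [a]) [] := by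
  simp [cutSum_append_cons]

lemma cutSum_nil_left {f : List α → List α → M} (h : ∀ a u v, f (a :: u) v = 0) (as : List α) :
    cutSum f as = f [] as := by
  cases as with
  | nil => simp
  | cons a as => simp [cutSum_cons, h]

lemma cutSum_cutSum_swap (f : List α → List α → List β → List β → M) (as : List α)
    (bs : List β) :
    cutSum (fun u v => cutSum (fun u' v' => f u v u' v') bs) as =
      cutSum (fun u' v' => cutSum (fun u v => f u v u' v') as) bs :=
  Finset.sum_comm

lemma unshuffleSum_cutSum_swap (f : ZWord 𝒵 → ZWord 𝒵 → List α → List α → M) (zs : ZWord 𝒵)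
    (as : List α) :
    unshuffleSum (fun L R => cutSum (fun u v => f L R u v) as) zs =
      cutSum (fun u v => unshuffleSum (fun L R => f L R u v) zs) as :=
  unshuffleSum_sum _ _ _

end cuts

/-! ### Simultaneous splittings of the two kinds of inputs -/

/-- `∑ ± f(z_L, a_I, z_R, a_J)` over all ways of splitting the inputs `z` and `a` into two parts,
where the sign is that of the permutation `z a ↦ z_L a_I z_R a_J`. -/
def splitSum (f : ZWord 𝒵 → List (Letter 𝒜 μ) → ZWord 𝒵 → List (Letter 𝒜 μ) → M)
    (zs : ZWord 𝒵) (as : List (Letter 𝒜 μ)) : M :=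
  unshuffleSum (fun L R => cutSum (fun I J => (wt R * wt I).negOnePow • f L I R J) as) zs

section splits

variable {f g : ZWord 𝒵 → List (Letter 𝒜 μ) → ZWord 𝒵 → List (Letter 𝒜 μ) → M}
  {zs : ZWord 𝒵} {as : List (Letter 𝒜 μ)}

lemma splitSum_congr
    (h : ∀ L I R J, wt L + wt R = wt zs → wt I + wt J = wt as → f L I R J = g L I R J) :
    splitSum f zs as = splitSum g zs as :=
  unshuffleSum_congr_of fun L R h1 _ => cutSum_congr fun I J h2 => by
    rw [h L I R J h1 (by rw [← h2, wt_append])]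

lemma map_splitSum (φ : M →+ N)
    (f : ZWord 𝒵 → List (Letter 𝒜 μ) → ZWord 𝒵 → List (Letter 𝒜 μ) → M)
    (zs : ZWord 𝒵) (as : List (Letter 𝒜 μ)) :
    φ (splitSum f zs as) = splitSum (fun L I R J => φ (f L I R J)) zs as := by
  simp only [splitSum, map_unshuffleSum, map_cutSum, map_negOnePow_smul]

lemma isFormalSum_splitSum (zs : ZWord 𝒵) (as : List (Letter 𝒜 μ)) :
    IsFormalSum (fun f : ZWord 𝒵 × List (Letter 𝒜 μ) × ZWord 𝒵 × List (Letter 𝒜 μ) → M =>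
      splitSum (fun L I R J => f (L, I, R, J)) zs as) :=
  ⟨splitSum (fun L I R J => FreeAbelianGroup.of (L, I, R, J)) zs as, fun f => by
    simp [map_splitSum]⟩

lemma splitSum_smul (n : ℤˣ)
    (f : ZWord 𝒵 → List (Letter 𝒜 μ) → ZWord 𝒵 → List (Letter 𝒜 μ) → M)
    (zs : ZWord 𝒵) (as : List (Letter 𝒜 μ)) :
    splitSum (fun L I R J => n • f L I R J) zs as = n • splitSum f zs as :=
  (isFormalSum_splitSum zs as).map_smul n (fun p => f p.1 p.2.1 p.2.2.1 p.2.2.2)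

lemma splitSum_add (f g : ZWord 𝒵 → List (Letter 𝒜 μ) → ZWord 𝒵 → List (Letter 𝒜 μ) → M)
    (zs : ZWord 𝒵) (as : List (Letter 𝒜 μ)) :
    splitSum (fun L I R J => f L I R J + g L I R J) zs as = splitSum f zs as + splitSum g zs as :=
  (isFormalSum_splitSum zs as).map_add (fun p => f p.1 p.2.1 p.2.2.1 p.2.2.2)
    (fun p => g p.1 p.2.1 p.2.2.1 p.2.2.2)

@[simp] lemma splitSum_zero (zs : ZWord 𝒵) (as : List (Letter 𝒜 μ)) :
    splitSum (fun _ _ _ _ => (0 : M)) zs as = 0 :=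
  (isFormalSum_splitSum zs as).map_zero

lemma splitSum_cutSum_swap {α : Type*}
    (f : ZWord 𝒵 → List (Letter 𝒜 μ) → ZWord 𝒵 → List (Letter 𝒜 μ) → List α → List α → M)
    (zs : ZWord 𝒵) (as : List (Letter 𝒜 μ)) (bs : List α) :
    splitSum (fun L I R J => cutSum (fun u v => f L I R J u v) bs) zs as =
      cutSum (fun u v => splitSum (fun L I R J => f L I R J u v) zs as) bs :=
  (isFormalSum_splitSum zs as).map_sum _
    (fun r p => f p.1 p.2.1 p.2.2.1 p.2.2.2 (bs.take r) (bs.drop r))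

/-- Coassociativity for both kinds of inputs at once. `h1` and `h2` bring each side to the sign of
the permutation that sorts `z a` into three consecutive pairs of blocks, a form that no longer
depends on the bracketing. -/
lemma splitSum_assoc (f : ZWord 𝒵 → List (Letter 𝒜 μ) → ZWord 𝒵 → List (Letter 𝒜 μ) →
      ZWord 𝒵 → List (Letter 𝒜 μ) → M) (zs : ZWord 𝒵) (as : List (Letter 𝒜 μ)) :
    splitSum (fun L I R J => splitSum (fun R₁ J₁ R₂ J₂ => f L I R₁ J₁ R₂ J₂) R J) zs as =
      splitSum (fun L I R J => splitSum (fun L₁ I₁ L₂ I₂ => f L₁ I₁ L₂ I₂ R J) L I) zs as := by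
  simp only [splitSum, ← cutSum_smul, ← unshuffleSum_smul, smul_smul, ← Int.negOnePow_add]
  simp only [← unshuffleSum_cutSum_swap]
  have h1 : ∀ L R : ZWord 𝒵, unshuffleSum (fun R₁ R₂ => cutSum (fun I J => cutSum (fun J₁ J₂ =>
        (wt R * wt I + wt R₂ * wt J₁).negOnePow • f L I R₁ J₁ R₂ J₂) J) as) R =
      unshuffleSum (fun R₁ R₂ => cutSum (fun I J => cutSum (fun J₁ J₂ =>
        ((wt R₁ + wt R₂) * wt I + wt R₂ * wt J₁).negOnePow • f L I R₁ J₁ R₂ J₂) J) as) R :=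
    fun L R => unshuffleSum_congr_of fun R₁ R₂ h _ => by rw [h]
  have h2 : ∀ L R : ZWord 𝒵, unshuffleSum (fun L₁ L₂ => cutSum (fun I J => cutSum (fun I₁ I₂ =>
        (wt R * wt I + wt L₂ * wt I₁).negOnePow • f L₁ I₁ L₂ I₂ R J) I) as) L =
      unshuffleSum (fun L₁ L₂ => cutSum (fun I J => cutSum (fun J₁ J₂ =>
        ((wt L₂ + wt R) * wt I + wt R * wt J₁).negOnePow • f L₁ I L₂ J₁ R J₂) J) as) L :=
    fun L R => unshuffleSum_congr (fun L₁ L₂ => by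
      rw [cutSum_assoc]
      refine cutSum_congr fun I J _ => cutSum_congr fun I₁ I₂ h => ?_
      rw [← h, wt_append]
      congr 2
      ring) L
  simp only [h1, h2]
  exact unshuffleSum_assoc _ zs

lemma splitSum_nil_left (h : ∀ z L I R J, f (z :: L) I R J = 0) :
    splitSum f zs as = cutSum (fun I J => (wt zs * wt I).negOnePow • f [] I zs J) as := by
  unfold splitSum
  rw [unshuffleSum_nil_left fun z L R => by simp [h]]

/-- Cutting the first part of a splitting of the inputs. -/
lemma splitSum_cutSum (f : ZWord 𝒵 → List (Letter 𝒜 μ) → List (Letter 𝒜 μ) → ZWord 𝒵 →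
      List (Letter 𝒜 μ) → M) (zs : ZWord 𝒵) (as : List (Letter 𝒜 μ)) :
    splitSum (fun L I R J => cutSum (fun I₁ I₂ => f L I₁ I₂ R J) I) zs as =
      cutSum (fun I₁ J => splitSum (fun L I₂ R J =>
        (wt R * wt I₁).negOnePow • f L I₁ I₂ R J) zs J) as := by
  simp only [splitSum, ← unshuffleSum_cutSum_swap, ← cutSum_smul]
  refine unshuffleSum_congr (fun L R => ?_) zs
  rw [cutSum_assoc]
  refine cutSum_congr fun I J _ => cutSum_congr fun I₁ I₂ h => ?_
  rw [← h, wt_append, smul_smul, ← Int.negOnePow_add]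
  congr 2
  ring

end splits

/-! ### Inserting operations into a word -/

abbrev AWord (𝒜 : ℤ → Submodule 𝕜 A) (μ : Type) := List (Letter 𝒜 μ)

/-- The total degree of a list of operations. -/
def degs (S : List (Op 𝒵 𝒜 μ)) : ℤ := (S.map Op.deg).sum

@[simp] lemma degs_nil : degs ([] : List (Op 𝒵 𝒜 μ)) = 0 := rfl

@[simp] lemma degs_cons (E : Op 𝒵 𝒜 μ) (S : List (Op 𝒵 𝒜 μ)) :
    degs (E :: S) = E.deg + degs S := by simp [degs]

@[simp] lemma degs_append (S T : List (Op 𝒵 𝒜 μ)) : degs (S ++ T) = degs S + degs T := by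
  simp [degs]

/-- The homogeneous element `E(z_L; a_K)`. -/
def Op.out (E : Op 𝒵 𝒜 μ) (L : ZWord 𝒵) (K : AWord 𝒜 μ) : Letter 𝒜 Unit :=
  ⟨E.deg + wt L + wt K, E.toFun L K, E.mem L K, ()⟩

@[simp] lemma Op.out_deg (E : Op 𝒵 𝒜 μ) (L : ZWord 𝒵) (K : AWord 𝒜 μ) :
    (E.out L K).deg = E.deg + wt L + wt K := rfl

/-- The sum of `± f(a_{I₀}, E₁(z_{L₁}; a_{K₁}), a_{I₁}, …, E_m(z_{L_m}; a_{K_m}), a_{I_m})` over all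
ways of distributing the inputs, with the sign of the permutation
`E₁ ⋯ E_m z a ↦ a_{I₀} E₁ z_{L₁} a_{K₁} a_{I₁} ⋯`. -/
def insertSum : List (Op 𝒵 𝒜 μ) → (AWord 𝒜 Unit → M) → ZWord 𝒵 → AWord 𝒜 μ → M
  | [], f, [], as => f (as.map (Letter.relabel ()))
  | [], _, _ :: _, _ => 0
  | E :: S, f, zs, as =>
      cutSum (fun I J => (wt I * (E.deg + degs S + wt zs)).negOnePow •
        splitSum (fun L K R T => (degs S * (wt L + wt K)).negOnePow •
          insertSum S (fun w => f (I.map (Letter.relabel ()) ++ E.out L K :: w)) R T) zs J) as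

@[simp] lemma insertSum_nil_cons (f : AWord 𝒜 Unit → M) (z : Letter 𝒵 Unit) (zs : ZWord 𝒵)
    (as : AWord 𝒜 μ) : insertSum [] f (z :: zs) as = 0 := rfl

@[simp] lemma insertSum_nil_nil (f : AWord 𝒜 Unit → M) (as : AWord 𝒜 μ) :
    insertSum ([] : List (Op 𝒵 𝒜 μ)) f [] as = f (as.map (Letter.relabel ())) := rfl

lemma map_insertSum (φ : M →+ N) (S : List (Op 𝒵 𝒜 μ)) (f : AWord 𝒜 Unit → M) (zs : ZWord 𝒵)
    (as : AWord 𝒜 μ) : φ (insertSum S f zs as) = insertSum S (fun w => φ (f w)) zs as := by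
  induction S generalizing f zs as with
  | nil => cases zs <;> simp
  | cons E S ih => simp only [insertSum, map_cutSum, map_splitSum, map_negOnePow_smul, ih]

lemma isFormalSum_insertSum (S : List (Op 𝒵 𝒜 μ)) (zs : ZWord 𝒵) (as : AWord 𝒜 μ) :
    IsFormalSum (fun f : AWord 𝒜 Unit → M => insertSum S f zs as) :=
  ⟨insertSum S FreeAbelianGroup.of zs as, fun f => by simp [map_insertSum]⟩

lemma insertSum_smul (S : List (Op 𝒵 𝒜 μ)) (n : ℤˣ) (f : AWord 𝒜 Unit → M) (zs : ZWord 𝒵)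
    (as : AWord 𝒜 μ) : insertSum S (fun w => n • f w) zs as = n • insertSum S f zs as :=
  (isFormalSum_insertSum S zs as).map_smul n f

lemma insertSum_add (S : List (Op 𝒵 𝒜 μ)) (f g : AWord 𝒜 Unit → M) (zs : ZWord 𝒵)
    (as : AWord 𝒜 μ) :
    insertSum S (fun w => f w + g w) zs as = insertSum S f zs as + insertSum S g zs as :=
  (isFormalSum_insertSum S zs as).map_add f g

@[simp] lemma insertSum_zero (S : List (Op 𝒵 𝒜 μ)) (zs : ZWord 𝒵) (as : AWord 𝒜 μ) :
    insertSum S (fun _ => (0 : M)) zs as = 0 :=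
  (isFormalSum_insertSum S zs as).map_zero

lemma insertSum_cutSum_swap {α : Type*} (S : List (Op 𝒵 𝒜 μ))
    (f : AWord 𝒜 Unit → List α → List α → M) (zs : ZWord 𝒵) (as : AWord 𝒜 μ) (bs : List α) :
    insertSum S (fun w => cutSum (fun u v => f w u v) bs) zs as =
      cutSum (fun u v => insertSum S (fun w => f w u v) zs as) bs :=
  (isFormalSum_insertSum S zs as).map_sum _ (fun r w => f w (bs.take r) (bs.drop r))

lemma insertSum_unshuffleSum_swap (S : List (Op 𝒵 𝒜 μ))
    (f : AWord 𝒜 Unit → ZWord 𝒵 → ZWord 𝒵 → M) (zs ys : ZWord 𝒵) (as : AWord 𝒜 μ) :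
    insertSum S (fun w => unshuffleSum (fun u v => f w u v) ys) zs as =
      unshuffleSum (fun u v => insertSum S (fun w => f w u v) zs as) ys :=
  (isFormalSum_insertSum S zs as).swap (isFormalSum_unshuffleSum ys) (fun w p => f w p.1 p.2)

lemma insertSum_splitSum_swap (S : List (Op 𝒵 𝒜 μ))
    (f : AWord 𝒜 Unit → ZWord 𝒵 → AWord 𝒜 ν → ZWord 𝒵 → AWord 𝒜 ν → M) (zs ys : ZWord 𝒵)
    (as : AWord 𝒜 μ) (bs : AWord 𝒜 ν) :
    insertSum S (fun w => splitSum (fun L I R J => f w L I R J) ys bs) zs as =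
      splitSum (fun L I R J => insertSum S (fun w => f w L I R J) zs as) ys bs :=
  (isFormalSum_insertSum S zs as).swap (isFormalSum_splitSum ys bs)
    (fun w p => f w p.1 p.2.1 p.2.2.1 p.2.2.2)

lemma insertSum_insertSum_swap (S : List (Op 𝒵 𝒜 μ)) (T : List (Op 𝒵 𝒜 ν))
    (f : AWord 𝒜 Unit → AWord 𝒜 Unit → M) (zs ys : ZWord 𝒵) (as : AWord 𝒜 μ)
    (bs : AWord 𝒜 ν) :
    insertSum S (fun w => insertSum T (fun x => f w x) ys bs) zs as =
      insertSum T (fun x => insertSum S (fun w => f w x) zs as) ys bs :=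
  (isFormalSum_insertSum S zs as).swap (isFormalSum_insertSum T ys bs) f

/-- Insertion preserves total degree, so the produced words all have the same weight. This is what
allows a sign depending on the weight of the produced word to be pulled out of an insertion sum. -/
lemma insertSum_congr {S : List (Op 𝒵 𝒜 μ)} {f g : AWord 𝒜 Unit → M} {zs : ZWord 𝒵}
    {as : AWord 𝒜 μ} (h : ∀ w, wt w = degs S + wt zs + wt as → f w = g w) :
    insertSum S f zs as = insertSum S g zs as := by
  induction S generalizing f g zs as with
  | nil =>
    cases zs with
    | nil => exact h _ (by simp)
    | cons z zs => rfl
  | cons E S ih =>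
    simp only [insertSum]
    refine cutSum_congr fun I J h1 => ?_
    congr 1
    refine splitSum_congr fun L K R T h2 h3 => ?_
    congr 1
    refine ih fun w hw => h _ ?_
    simp only [← h1, wt_append, wt_relabel, wt_cons, Op.out_deg, hw, degs_cons]
    omega

/-- Each operation contributes a letter even when it has no inputs, so the produced word is empty
only if there are neither operations nor `a`'s. It is needed because `form_cyc` fails to apply when
all inputs are absent. -/
lemma insertSum_congr_of_ne_nil {S : List (Op 𝒵 𝒜 μ)} {f g : AWord 𝒜 Unit → M} {zs : ZWord 𝒵}
    {as : AWord 𝒜 μ} (hne : S ≠ [] ∨ as ≠ []) (h : ∀ w, w ≠ [] → f w = g w) :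
    insertSum S f zs as = insertSum S g zs as := by
  cases S with
  | nil =>
    cases zs with
    | nil => exact h _ (by simpa using hne)
    | cons z zs => rfl
  | cons E S =>
    simp only [insertSum]
    refine cutSum_congr fun I J h1 => ?_
    congr 1
    refine splitSum_congr fun L K R T h2 h3 => ?_
    congr 2
    funext w
    exact h _ (by simp)

lemma insertSum_nil_split (f : ZWord 𝒵 → AWord 𝒜 μ → AWord 𝒜 Unit → M) (zs : ZWord 𝒵)
    (as : AWord 𝒜 μ) :
    splitSum (fun L I R J => insertSum ([] : List (Op 𝒵 𝒜 μ)) (f R J) L I) zs as =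
      cutSum (fun I J => (wt zs * wt I).negOnePow • f zs J (I.map (Letter.relabel ()))) as :=
  splitSum_nil_left fun _ _ _ _ _ => rfl

/-- Cutting the word produced by `insertSum`. -/
theorem insertSum_cutSum (S : List (Op 𝒵 𝒜 μ)) (f : AWord 𝒜 Unit → AWord 𝒜 Unit → M)
    (zs : ZWord 𝒵) (as : AWord 𝒜 μ) :
    insertSum S (fun w => cutSum f w) zs as =
      cutSum (fun S₁ S₂ => splitSum (fun L I R J => (degs S₂ * (wt L + wt I)).negOnePow •
        insertSum S₁ (fun u => insertSum S₂ (fun v => f u v) R J) L I) zs as) S := by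
  induction S generalizing f zs as with
  | nil =>
    simp only [cutSum_nil, degs_nil, zero_mul, Int.negOnePow_zero, one_smul]
    rw [insertSum_nil_split (fun R J u => insertSum [] (fun v => f u v) R J)]
    cases zs with
    | nil => simp [cutSum_map]
    | cons z zs => simp
  | cons E S ih =>
    rw [cutSum_cons]
    -- A cut of the produced word falls either inside the block `I` preceding the output of `E`, so
    -- that all operations go to the right-hand word, or after that output, so that `E` goes to the
    -- left-hand one. These are the two terms of `cutSum_cons` on the right.
    conv_lhs =>
      simp only [insertSum, cutSum_append_cons, insertSum_add, splitSum_add, smul_add, cutSum_add]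
    congr 1
    · simp only [cutSum_map, insertSum_cutSum_swap, ← cutSum_smul, splitSum_cutSum_swap]
      refine ((cutSum_congr fun I J _ => cutSum_congr fun I₁ I₂ h => ?_).trans (cutSum_assoc
        (fun I₁ I₂ J => ((wt I₁ + wt I₂) * (E.deg + degs S + wt zs)).negOnePow •
          splitSum (fun L K R T => (degs S * (wt L + wt K)).negOnePow •
            insertSum S (fun w => f (I₁.map (Letter.relabel ()))
              (I₂.map (Letter.relabel ()) ++ E.out L K :: w)) R T) zs J) as).symm).trans ?_
      · rw [← h, wt_append]
      rw [splitSum_nil_left (by simp)]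
      refine cutSum_congr fun I J _ => ?_
      simp only [insertSum, ← cutSum_smul]
      refine cutSum_congr fun I' J' _ => ?_
      simp only [← splitSum_smul, smul_smul, ← Int.negOnePow_add]
      refine splitSum_congr fun L K R T _ _ => ?_
      congr 1
      apply negOnePow_congr
      simp only [wt_nil, degs_cons]
      push_cast; grind
    · simp only [ih, insertSum]
      simp only [splitSum_cutSum_swap, ← cutSum_smul]
      rw [cutSum_cutSum_swap]
      refine cutSum_congr fun S₁ S₂ hS => ?_
      let c : AWord 𝒜 μ → ZWord 𝒵 → AWord 𝒜 μ → ZWord 𝒵 → AWord 𝒜 μ → ZWord 𝒵 → AWord 𝒜 μ → M :=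
        fun I L K L' T R J => insertSum S₁ (fun u => insertSum S₂ (fun v =>
          f (I.map (Letter.relabel ()) ++ E.out L K :: u) v) R J) L' T
      -- Common form of the two sides: `(L₁, I₁)` are the inputs that build the left word,
      -- subdivided into the `a`'s before `E`, the inputs `(L, K)` of `E`, and the inputs `(L', T)`
      -- of `S₁`.
      trans splitSum (fun L₁ I₁ R J => cutSum (fun I I₂ => splitSum (fun L K L' T =>
        (degs S₂ * (wt L + wt L' + wt I + wt K + wt T) + wt I * (E.deg + degs S₁ + wt L + wt L') +
          degs S₁ * (wt L + wt K)).negOnePow • c I L K L' T R J) L₁ I₂) I₁) zs as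
      · rw [splitSum_cutSum (fun L₁ I I₂ R J => splitSum (fun L K L' T =>
          (degs S₂ * (wt L + wt L' + wt I + wt K + wt T) + wt I * (E.deg + degs S₁ + wt L + wt L') +
          degs S₁ * (wt L + wt K)).negOnePow • c I L K L' T R J) L₁ I₂)]
        refine cutSum_congr fun I J' _ => ?_
        simp only [← splitSum_smul]
        rw [← splitSum_assoc (fun L K L' T R J => (wt R * wt I).negOnePow •
          (degs S₂ * (wt L + wt L' + wt I + wt K + wt T) + wt I * (E.deg + degs S₁ + wt L + wt L') +
          degs S₁ * (wt L + wt K)).negOnePow • c I L K L' T R J)]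
        refine splitSum_congr fun L K R' T' h1 h2 => splitSum_congr fun L' T R J h3 h4 => ?_
        simp only [smul_smul, ← Int.negOnePow_add]
        congr 1
        apply negOnePow_congr
        rw [← h1, ← h3, ← hS, degs_append]
        push_cast; grind
      · refine splitSum_congr fun L₁ I₁ R J h1 h2 => cutSum_congr fun I I₂ h3 => ?_
        simp only [← splitSum_smul]
        refine splitSum_congr fun L K L' T h4 h5 => ?_
        simp only [smul_smul, ← Int.negOnePow_add]
        congr 1
        apply negOnePow_congr
        rw [← h4, ← h3, wt_append, ← h5]
        push_cast; grind

/-- The word produced by a list of operations, cut before and after a given operation. -/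
theorem insertSum_append_cons (S V : List (Op 𝒵 𝒜 μ)) (E : Op 𝒵 𝒜 μ) (f : AWord 𝒜 Unit → M)
    (zs : ZWord 𝒵) (as : AWord 𝒜 μ) :
    insertSum (S ++ E :: V) f zs as =
      splitSum (fun L₀ I R₀ J => splitSum (fun L K R T =>
        ((E.deg + degs V) * (wt L₀ + wt I) + degs V * (wt L + wt K)).negOnePow •
          insertSum S (fun w => insertSum V (fun x => f (w ++ E.out L K :: x)) R T) L₀ I)
        R₀ J) zs as := by
  induction S generalizing f zs as with
  | nil =>
    rw [splitSum_nil_left (by simp)]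
    simp only [List.nil_append, insertSum]
    refine cutSum_congr fun I J _ => ?_
    simp only [← splitSum_smul]
    refine splitSum_congr fun L K R T h1 h2 => ?_
    simp only [smul_smul, ← Int.negOnePow_add]
    congr 1
    apply negOnePow_congr
    rw [wt_nil]
    push_cast; grind
  | cons G S ih =>
    simp only [List.cons_append, insertSum, ih]
    -- `c` is the common summand and `p` its sign exponent: `I` is passed on, `(L₁, K₁)` goes to
    -- `G`, `(L₂, I₂)` to `S`, `(L, K)` to `E` and `(R, T)` to `V`.
    let c : AWord 𝒜 μ → ZWord 𝒵 → AWord 𝒜 μ → ZWord 𝒵 → AWord 𝒜 μ → ZWord 𝒵 → AWord 𝒜 μ →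
        ZWord 𝒵 → AWord 𝒜 μ → M :=
      fun I L₁ K₁ L₂ I₂ L K R T => insertSum S (fun w => insertSum V (fun x =>
        f (I.map (Letter.relabel ()) ++ G.out L₁ K₁ :: (w ++ E.out L K :: x))) R T) L₂ I₂
    let p : AWord 𝒜 μ → ZWord 𝒵 → AWord 𝒜 μ → ZWord 𝒵 → AWord 𝒜 μ → ZWord 𝒵 → AWord 𝒜 μ →
        ZWord 𝒵 → AWord 𝒜 μ → ℤ :=
      fun I L₁ K₁ L₂ I₂ L K R T => (E.deg + degs V) * (wt L₁ + wt L₂ + wt I + wt K₁ + wt I₂) +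
        degs V * (wt L + wt K) + wt I * (G.deg + degs S + wt L₁ + wt L₂) +
          degs S * (wt L₁ + wt K₁)
    trans splitSum (fun L₀ I₀ R₀ J => cutSum (fun I I' => splitSum (fun L₁ K₁ L₂ I₂ =>
      splitSum (fun L K R T => (p I L₁ K₁ L₂ I₂ L K R T).negOnePow • c I L₁ K₁ L₂ I₂ L K R T)
        R₀ J) L₀ I') I₀) zs as
    · rw [splitSum_cutSum (fun L₀ I I' R₀ J => splitSum (fun L₁ K₁ L₂ I₂ =>
        splitSum (fun L K R T => (p I L₁ K₁ L₂ I₂ L K R T).negOnePow • c I L₁ K₁ L₂ I₂ L K R T)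
          R₀ J) L₀ I')]
      refine cutSum_congr fun I J' _ => ?_
      simp only [← splitSum_smul]
      rw [← splitSum_assoc (fun L₁ K₁ L₂ I₂ R₀ J => splitSum (fun L K R T =>
        (wt R₀ * wt I).negOnePow • (p I L₁ K₁ L₂ I₂ L K R T).negOnePow •
          c I L₁ K₁ L₂ I₂ L K R T) R₀ J)]
      refine splitSum_congr fun L₁ K₁ R' T' h1 h2 => splitSum_congr fun L₂ I₂ R₀ J h3 h4 =>
        splitSum_congr fun L K R T h5 h6 => ?_
      simp only [smul_smul, ← Int.negOnePow_add]
      congr 1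
      apply negOnePow_congr
      rw [← h1, ← h3]
      simp only [p, degs_append, degs_cons]
      push_cast; grind
    · refine splitSum_congr fun L₀ I₀ R₀ J h1 h2 => ?_
      conv_rhs => simp only [← cutSum_smul, ← splitSum_smul, splitSum_cutSum_swap]
      refine cutSum_congr fun I I' h3 => ?_
      rw [(isFormalSum_splitSum R₀ J).swap (isFormalSum_splitSum L₀ I') (fun a b =>
        ((E.deg + degs V) * (wt L₀ + wt I₀) + degs V * (wt a.1 + wt a.2.1)).negOnePow •
        (wt I * (G.deg + degs S + wt L₀)).negOnePow •
        (degs S * (wt b.1 + wt b.2.1)).negOnePow • insertSum S (fun w => insertSum V (fun x =>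
          f (I.map (Letter.relabel ()) ++ G.out b.1 b.2.1 :: w ++ E.out a.1 a.2.1 :: x))
          a.2.2.1 a.2.2.2) b.2.2.1 b.2.2.2)]
      refine splitSum_congr fun L₁ K₁ L₂ I₂ h4 h5 => splitSum_congr fun L K R T h6 h7 => ?_
      simp only [smul_smul, ← Int.negOnePow_add, c, List.append_assoc, List.cons_append]
      congr 1
      apply negOnePow_congr
      rw [← h3, wt_append, ← h4, ← h5]
      simp only [p]
      push_cast; grind

/-! ### Braces as sums over insertions -/

@[simp] lemma map_relabel_unit (as : AWord 𝒜 Unit) : as.map (Letter.relabel ()) = as := by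
  have : (Letter.relabel () : Letter 𝒜 Unit → Letter 𝒜 Unit) = id := rfl
  rw [this, List.map_id]

/-- `plug` remembers the degrees of everything already placed, whereas `insertSum` starts afresh.
The discrepancy is the sign of moving the remaining operations past the earlier `z`'s, and the
remaining operations and `z`'s past the earlier `a`'s. -/
lemma plug_eq_insertSum (D : Cochain 𝒵 𝒜) (L₀ : ZWord 𝒵) (S : List (Op 𝒵 𝒜 μ)) (ζ α : ℤ)
    (w : AWord 𝒜 Unit) (zs : ZWord 𝒵) (as : AWord 𝒜 μ) :
    plug D L₀ S ζ α w zs as = (ζ * degs S + α * (degs S + wt zs)).negOnePow •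
      insertSum S (fun x => D.toFun L₀ (w ++ x)) zs as := by
  induction S generalizing ζ α w zs as with
  | nil => cases zs <;> simp [plug]
  | cons E S ih =>
    simp only [plug, ih, insertSum, splitSum, ← unshuffleSum_cutSum_swap, ← cutSum_smul,
      ← unshuffleSum_smul]
    refine unshuffleSum_congr_of fun L R h1 _ => cutSum_congr fun I J h2 =>
      cutSum_congr fun K T h3 => ?_
    simp only [smul_smul, ← Int.negOnePow_add, List.append_assoc, List.singleton_append]
    congr 1
    apply negOnePow_congr
    rw [← h1, degs_cons]
    push_cast; grind

lemma brace_toFun (D : Cochain 𝒵 𝒜) (S : List (Op 𝒵 𝒜 μ)) (zs : ZWord 𝒵) (as : AWord 𝒜 μ) :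
    (brace D S).toFun zs as = unshuffleSum (fun L R => (wt L * degs S).negOnePow •
      insertSum S (D.toFun L) R as) zs := by
  refine unshuffleSum_congr (fun L R => ?_) zs
  rw [plug_eq_insertSum]
  simp

lemma brace_deg (D : Cochain 𝒵 𝒜) (S : List (Op 𝒵 𝒜 μ)) : (brace D S).deg = D.deg + degs S := rfl

/-- A function on words which is additive in every letter. -/
def LetterAdditive (f : AWord 𝒜 Unit → M) : Prop :=
  ∀ (l r : AWord 𝒜 Unit) (d : ℤ), ∃ φ : A →+ M, ∀ (x : A) (hx : x ∈ 𝒜 d),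
    f (l ++ ⟨d, x, hx, ()⟩ :: r) = φ x

lemma LetterAdditive.append {f : AWord 𝒜 Unit → M} (hf : LetterAdditive f) (u : AWord 𝒜 Unit) :
    LetterAdditive (fun w => f (u ++ w)) := fun l r d => by
  simpa only [List.append_assoc] using hf (u ++ l) r d

lemma LetterAdditive.cons {f : AWord 𝒜 Unit → M} (hf : LetterAdditive f) (a : Letter 𝒜 Unit) :
    LetterAdditive (fun w => f (a :: w)) := hf.append [a]

lemma LetterAdditive.append_right {f : AWord 𝒜 Unit → M} (hf : LetterAdditive f)
    (u : AWord 𝒜 Unit) : LetterAdditive (fun w => f (w ++ u)) := fun l r d => by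
  simpa only [List.append_assoc, List.cons_append] using hf l (r ++ u) d

lemma LetterAdditive.comp {f : AWord 𝒜 Unit → M} (hf : LetterAdditive f) (ψ : M →+ N) :
    LetterAdditive (fun w => ψ (f w)) := fun l r d => by
  obtain ⟨φ, hφ⟩ := hf l r d
  exact ⟨ψ.comp φ, fun x hx => by simp [hφ]⟩

/-- `D` is linear only on each `𝒜 d`; composing with the projection of `A` onto that component gives
a map defined on all of `A`. This is where the direct sum decomposition of `A` enters. -/
lemma letterAdditive_toFun [DirectSum.Decomposition 𝒜] (D : Cochain 𝒵 𝒜) (zs : ZWord 𝒵) :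
    LetterAdditive (D.toFun zs) := fun l r d => by
  refine ⟨(((D.lin_right zs l r d ()).mk' _).comp
    ((DirectSum.component 𝕜 ℤ (fun i => 𝒜 i) d).comp
      (DirectSum.decomposeLinearEquiv 𝒜).toLinearMap)).toAddMonoidHom, fun x hx => ?_⟩
  have h : DirectSum.decompose 𝒜 x d = ⟨x, hx⟩ :=
    Subtype.ext (DirectSum.decompose_of_mem_same 𝒜 hx)
  change _ = D.toFun zs (l ++ ⟨d, (DirectSum.decompose 𝒜 x d).1, (DirectSum.decompose 𝒜 x d).2, ()⟩ :: r)
  simp only [h]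

/-- A brace as one of the letters of a word. -/
lemma LetterAdditive.apply_brace_out {f : AWord 𝒜 Unit → M} (hf : LetterAdditive f)
    (l r : AWord 𝒜 Unit) (E : Cochain 𝒵 𝒜) (G : List (Op 𝒵 𝒜 μ)) (zs : ZWord 𝒵)
    (as : AWord 𝒜 μ) :
    f (l ++ (brace E G).out zs as :: r) = unshuffleSum (fun P R => (wt P * degs G).negOnePow •
      insertSum G (fun w => f (l ++ E.out P w :: r)) R as) zs := by
  obtain ⟨φ, hφ⟩ := hf l r ((brace E G).deg + wt zs + wt as)
  rw [Op.out, hφ, brace_toFun, map_unshuffleSum]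
  refine unshuffleSum_congr_of fun P R h _ => ?_
  rw [map_negOnePow_smul, map_insertSum]
  congr 1
  refine insertSum_congr fun w hw => ?_
  -- The degree stored in the letter built from `E` and `w` equals that of the brace only
  -- propositionally, so the membership proof is left arbitrary and the equality of degrees is
  -- substituted.
  have key : ∀ d (hd : d = (brace E G).deg + wt zs + wt as) (hx : E.toFun P w ∈ 𝒜 d),
      φ (E.toFun P w) = f (l ++ ⟨d, E.toFun P w, hx, ()⟩ :: r) := by
    rintro d rfl hx
    rw [hφ]
  refine key _ ?_ _
  rw [brace_deg, hw, ← h]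
  ring

/-! ### Composing insertions -/

/-- The operations `E` are inserted into the word obtained by inserting the operations `G`. -/
def composeSum (E : List (Cochain 𝒵 𝒜)) (G : List (Op 𝒵 𝒜 μ)) (f : AWord 𝒜 Unit → M)
    (zs : ZWord 𝒵) (as : AWord 𝒜 μ) : M :=
  unshuffleSum (fun P R => (degs G * wt P).negOnePow •
    insertSum G (fun w => insertSum E f P w) R as) zs

/-- The part of `insertSum (E :: S)` in which `E` produces the first letter. -/
def insertHead (E : Op 𝒵 𝒜 μ) (S : List (Op 𝒵 𝒜 μ)) (f : AWord 𝒜 Unit → M) (zs : ZWord 𝒵)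
    (as : AWord 𝒜 μ) : M :=
  splitSum (fun L K R T => (degs S * (wt L + wt K)).negOnePow •
    insertSum S (fun w => f (E.out L K :: w)) R T) zs as

lemma insertSum_cons (E : Op 𝒵 𝒜 μ) (S : List (Op 𝒵 𝒜 μ)) (f : AWord 𝒜 Unit → M)
    (zs : ZWord 𝒵) (as : AWord 𝒜 μ) :
    insertSum (E :: S) f zs as =
      cutSum (fun I J => (wt I * (E.deg + degs S + wt zs)).negOnePow •
        insertHead E S (fun w => f (I.map (Letter.relabel ()) ++ w)) zs J) as := rfl

/-- The part of `composeSum (E :: S) G` in which `E` produces the first letter. -/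
def composeHead (E : Cochain 𝒵 𝒜) (S : List (Cochain 𝒵 𝒜)) (G : List (Op 𝒵 𝒜 μ))
    (f : AWord 𝒜 Unit → M) (zs : ZWord 𝒵) (as : AWord 𝒜 μ) : M :=
  unshuffleSum (fun P R => (degs G * wt P).negOnePow •
    insertSum G (fun w => insertHead E S f P w) R as) zs

lemma unshuffleSum_left_comm (f : ZWord 𝒵 → ZWord 𝒵 → ZWord 𝒵 → M) (zs : ZWord 𝒵) :
    unshuffleSum (fun P R => unshuffleSum (fun R₁ R₂ => f P R₁ R₂) R) zs =
      unshuffleSum (fun R₁ X => unshuffleSum (fun P R₂ =>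
        (wt P * wt R₁).negOnePow • f P R₁ R₂) X) zs := by
  rw [unshuffleSum_assoc, unshuffleSum_assoc (fun R₁ P R₂ => (wt P * wt R₁).negOnePow • f P R₁ R₂)]
  refine unshuffleSum_congr (fun X R₂ => ?_) zs
  rw [unshuffleSum_comm]
  refine unshuffleSum_congr (fun R₁ P => ?_) X
  rw [mul_comm]

/-- The letters to the left of the output of `E` are passed on untouched. Cutting the intermediate
word there splits `G` into `G₀`, which produces those letters, and `G'`, on whose word `E` acts
first. -/
lemma composeSum_cons (E : Cochain 𝒵 𝒜) (S : List (Cochain 𝒵 𝒜)) (G : List (Op 𝒵 𝒜 μ))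
    (f : AWord 𝒜 Unit → M) (zs : ZWord 𝒵) (as : AWord 𝒜 μ) :
    composeSum (E :: S) G f zs as = cutSum (fun G₀ G' => splitSum (fun Z₀ I Z' J =>
      ((E.deg + degs S) * (degs G₀ + wt Z₀ + wt I) + degs G' * (wt Z₀ + wt I)).negOnePow •
        insertSum G₀ (fun w => composeHead E S G' (fun x => f (w ++ x)) Z' J) Z₀ I) zs as) G := by
  let c : List (Op 𝒵 𝒜 μ) → List (Op 𝒵 𝒜 μ) → ZWord 𝒵 → ZWord 𝒵 → ZWord 𝒵 →
      AWord 𝒜 μ → AWord 𝒜 μ → M :=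
    fun G₀ G' P R₀ R' I J => insertSum G₀ (fun w => insertSum G' (fun w' =>
      insertHead E S (fun x => f (w ++ x)) P w') R' J) R₀ I
  trans cutSum (fun G₀ G' => unshuffleSum (fun P R => unshuffleSum (fun R₀ R' =>
    cutSum (fun I J => ((degs G₀ + degs G') * wt P + wt R' * wt I + degs G' * (wt R₀ + wt I) +
      (degs G₀ + wt R₀ + wt I) * (E.deg + degs S + wt P)).negOnePow • c G₀ G' P R₀ R' I J) as) R)
      zs) G
  · rw [← unshuffleSum_cutSum_swap]
    refine unshuffleSum_congr (fun P R => ?_) zs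
    simp only [insertSum_cons, map_relabel_unit]
    rw [insertSum_cutSum, ← cutSum_smul]
    refine cutSum_congr fun G₀ G' hG => ?_
    rw [splitSum, ← unshuffleSum_smul]
    refine unshuffleSum_congr (fun R₀ R' => ?_) R
    rw [← cutSum_smul]
    refine cutSum_congr fun I J h => ?_
    have h1 : insertSum G₀ (fun u => insertSum G' (fun v =>
        (wt u * (E.deg + degs S + wt P)).negOnePow •
          insertHead E S (fun w => f (u ++ w)) P v) R' J) R₀ I =
        ((degs G₀ + wt R₀ + wt I) * (E.deg + degs S + wt P)).negOnePow • c G₀ G' P R₀ R' I J := by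
      rw [← insertSum_smul]
      refine insertSum_congr fun w hw => ?_
      rw [hw, insertSum_smul]
    rw [h1]
    simp only [smul_smul, ← Int.negOnePow_add]
    congr 1
    apply negOnePow_congr
    rw [← hG, degs_append]
    push_cast; grind
  · refine cutSum_congr fun G₀ G' hG => ?_
    rw [unshuffleSum_left_comm]
    refine unshuffleSum_congr (fun R₀ X => ?_) zs
    simp only [composeHead, insertSum_unshuffleSum_swap, ← unshuffleSum_smul,
      ← unshuffleSum_cutSum_swap, insertSum_smul, ← cutSum_smul]
    refine unshuffleSum_congr_of fun P R' h _ => cutSum_congr fun I J _ => ?_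
    simp only [smul_smul, ← Int.negOnePow_add]
    congr 1
    apply negOnePow_congr
    rw [← h]
    push_cast; grind

/-- `E` consumes an initial run of the intermediate word. Cutting after this run splits `G` into
`G₁`, absorbed into `brace E G₁`, and `G₂`, into whose word the remaining `S` are inserted.
Additivity of `f` is needed to expand the brace when it occurs as a letter. -/
lemma composeHead_eq (E : Cochain 𝒵 𝒜) (S : List (Cochain 𝒵 𝒜)) (G : List (Op 𝒵 𝒜 μ))
    {f : AWord 𝒜 Unit → M} (hf : LetterAdditive f) (zs : ZWord 𝒵) (as : AWord 𝒜 μ) :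
    composeHead E S G f zs as = cutSum (fun G₁ G₂ => splitSum (fun L K R T =>
      (degs S * (degs G₁ + wt L + wt K) + degs G₂ * (wt L + wt K)).negOnePow •
        composeSum S G₂ (fun x => f ((brace E G₁).out L K :: x)) R T) zs as) G := by
  let c : List (Op 𝒵 𝒜 μ) → List (Op 𝒵 𝒜 μ) → ZWord 𝒵 → ZWord 𝒵 → ZWord 𝒵 → ZWord 𝒵 →
      AWord 𝒜 μ → AWord 𝒜 μ → M :=
    fun G₁ G₂ P₁ P₂ R₁ R₂ K T => insertSum G₁ (fun w₁ => insertSum G₂ (fun w₂ =>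
      insertSum S (fun x => f (E.out P₁ w₁ :: x)) P₂ w₂) R₂ T) R₁ K
  trans cutSum (fun G₁ G₂ => unshuffleSum (fun P R => unshuffleSum (fun P₁ P₂ =>
    unshuffleSum (fun R₁ R₂ => cutSum (fun K T => ((degs G₁ + degs G₂) * (wt P₁ + wt P₂) +
      wt R₂ * wt K + degs G₂ * (wt R₁ + wt K) + wt P₂ * (degs G₁ + wt R₁ + wt K) +
      degs S * (wt P₁ + degs G₁ + wt R₁ + wt K)).negOnePow • c G₁ G₂ P₁ P₂ R₁ R₂ K T) as) R) P)
      zs) G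
  · rw [← unshuffleSum_cutSum_swap]
    refine unshuffleSum_congr (fun P R => ?_) zs
    simp only [insertHead, splitSum]
    rw [insertSum_unshuffleSum_swap, ← unshuffleSum_smul, ← unshuffleSum_cutSum_swap]
    refine unshuffleSum_congr_of fun P₁ P₂ hP _ => ?_
    rw [insertSum_cutSum, ← cutSum_smul]
    refine cutSum_congr fun G₁ G₂ hG => ?_
    rw [splitSum, ← unshuffleSum_smul]
    refine unshuffleSum_congr (fun R₁ R₂ => ?_) R
    rw [← cutSum_smul]
    refine cutSum_congr fun K T h => ?_
    have h1 : insertSum G₁ (fun u => insertSum G₂ (fun v =>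
        (wt P₂ * wt u).negOnePow • (degs S * (wt P₁ + wt u)).negOnePow •
          insertSum S (fun x => f (E.out P₁ u :: x)) P₂ v) R₂ T) R₁ K =
        (wt P₂ * (degs G₁ + wt R₁ + wt K) +
          degs S * (wt P₁ + (degs G₁ + wt R₁ + wt K))).negOnePow •
            c G₁ G₂ P₁ P₂ R₁ R₂ K T := by
      rw [← insertSum_smul]
      refine insertSum_congr fun w hw => ?_
      simp only [hw, insertSum_smul, smul_smul, ← Int.negOnePow_add]
    rw [h1]
    simp only [smul_smul, ← Int.negOnePow_add]
    congr 1
    apply negOnePow_congr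
    rw [← hG, degs_append, ← hP]
    push_cast; grind
  · refine cutSum_congr fun G₁ G₂ hG => ?_
    -- The `z`'s taken by `E` and by `G₁` are brought together as the inputs of `brace E G₁`; those
    -- taken by `S` and `G₂` form the rest.
    rw [unshuffleSum_interchange, splitSum]
    refine unshuffleSum_congr (fun L R => ?_) zs
    have h1 : ∀ x K, f ((brace E G₁).out L K :: x) = _ := fun x K =>
      hf.apply_brace_out [] x E G₁ L K
    simp only [h1, composeSum, List.nil_append, insertSum_unshuffleSum_swap, insertSum_smul,
      ← unshuffleSum_smul, ← unshuffleSum_cutSum_swap, ← cutSum_smul]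
    rw [unshuffleSum_unshuffleSum_swap]
    refine unshuffleSum_congr_of fun P₂ R₂ h2 _ => unshuffleSum_congr_of fun P₁ R₁ h3 _ =>
      cutSum_congr fun K T _ => ?_
    simp only [c]
    rw [insertSum_insertSum_swap G₁ G₂]
    simp only [insertSum_insertSum_swap G₁ S, smul_smul, ← Int.negOnePow_add]
    congr 1
    apply negOnePow_congr
    rw [← h2, ← h3]
    push_cast; grind

/-- The sum of `± φ(G₁, …, G_{i₁}, E₁{G_{i₁+1}, …, G_{j₁}}, G_{j₁+1}, …, E_m{G_{i_m+1}, …, G_{j_m}};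
G_{j_m+1}, …, G_n)` over all `0 ≤ i₁ ≤ j₁ ≤ ⋯ ≤ i_m ≤ j_m ≤ n`. -/
def weaveSum : List (Cochain 𝒵 𝒜) → List (Op 𝒵 𝒜 μ) →
    (List (Op 𝒵 𝒜 μ) → List (Op 𝒵 𝒜 μ) → M) → M
  | [], G, φ => φ [] G
  | E :: S, G, φ =>
      cutSum (fun G₀ G' => cutSum (fun G₁ G₂ =>
        (E.deg * degs G₀ + degs S * (degs G₀ + degs G₁)).negOnePow •
          weaveSum S G₂ (fun V T => φ (G₀ ++ brace E G₁ :: V) T)) G') G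

lemma map_weaveSum (ψ : M →+ N) (E : List (Cochain 𝒵 𝒜)) (G : List (Op 𝒵 𝒜 μ))
    (φ : List (Op 𝒵 𝒜 μ) → List (Op 𝒵 𝒜 μ) → M) :
    ψ (weaveSum E G φ) = weaveSum E G (fun V T => ψ (φ V T)) := by
  induction E generalizing G φ with
  | nil => rfl
  | cons E S ih => simp only [weaveSum, map_cutSum, map_negOnePow_smul, ih]

lemma isFormalSum_weaveSum (E : List (Cochain 𝒵 𝒜)) (G : List (Op 𝒵 𝒜 μ)) :
    IsFormalSum (fun φ : List (Op 𝒵 𝒜 μ) × List (Op 𝒵 𝒜 μ) → M =>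
      weaveSum E G (fun V T => φ (V, T))) :=
  ⟨weaveSum E G (fun V T => FreeAbelianGroup.of (V, T)), fun f => by simp [map_weaveSum]⟩

lemma weaveSum_smul (E : List (Cochain 𝒵 𝒜)) (G : List (Op 𝒵 𝒜 μ)) (n : ℤˣ)
    (φ : List (Op 𝒵 𝒜 μ) → List (Op 𝒵 𝒜 μ) → M) :
    weaveSum E G (fun V T => n • φ V T) = n • weaveSum E G φ :=
  (isFormalSum_weaveSum E G).map_smul n (fun p => φ p.1 p.2)

@[simp] lemma weaveSum_zero (E : List (Cochain 𝒵 𝒜)) (G : List (Op 𝒵 𝒜 μ)) :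
    weaveSum E G (fun _ _ => (0 : M)) = 0 :=
  (isFormalSum_weaveSum E G).map_zero

lemma weaveSum_cutSum_swap {α : Type*} (E : List (Cochain 𝒵 𝒜)) (G : List (Op 𝒵 𝒜 μ))
    (φ : List (Op 𝒵 𝒜 μ) → List (Op 𝒵 𝒜 μ) → List α → List α → M) (as : List α) :
    weaveSum E G (fun V T => cutSum (fun u v => φ V T u v) as) =
      cutSum (fun u v => weaveSum E G (fun V T => φ V T u v)) as :=
  (isFormalSum_weaveSum E G).map_sum _ (fun r p => φ p.1 p.2 (as.take r) (as.drop r))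

lemma weaveSum_unshuffleSum_swap (E : List (Cochain 𝒵 𝒜)) (G : List (Op 𝒵 𝒜 μ))
    (φ : List (Op 𝒵 𝒜 μ) → List (Op 𝒵 𝒜 μ) → ZWord 𝒵 → ZWord 𝒵 → M) (zs : ZWord 𝒵) :
    weaveSum E G (fun V T => unshuffleSum (fun u v => φ V T u v) zs) =
      unshuffleSum (fun u v => weaveSum E G (fun V T => φ V T u v)) zs :=
  (isFormalSum_weaveSum E G).swap (isFormalSum_unshuffleSum zs)
    (fun p q => φ p.1 p.2 q.1 q.2)

lemma weaveSum_splitSum_swap (E : List (Cochain 𝒵 𝒜)) (G : List (Op 𝒵 𝒜 μ))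
    (φ : List (Op 𝒵 𝒜 μ) → List (Op 𝒵 𝒜 μ) → ZWord 𝒵 → AWord 𝒜 ν → ZWord 𝒵 → AWord 𝒜 ν → M)
    (zs : ZWord 𝒵) (as : AWord 𝒜 ν) :
    weaveSum E G (fun V T => splitSum (fun L I R J => φ V T L I R J) zs as) =
      splitSum (fun L I R J => weaveSum E G (fun V T => φ V T L I R J)) zs as :=
  (isFormalSum_weaveSum E G).swap (isFormalSum_splitSum zs as)
    (fun p q => φ p.1 p.2 q.1 q.2.1 q.2.2.1 q.2.2.2)

lemma insertSum_weaveSum_swap (S : List (Op 𝒵 𝒜 ν)) (E : List (Cochain 𝒵 𝒜))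
    (G : List (Op 𝒵 𝒜 μ)) (φ : AWord 𝒜 Unit → List (Op 𝒵 𝒜 μ) → List (Op 𝒵 𝒜 μ) → M)
    (zs : ZWord 𝒵) (as : AWord 𝒜 ν) :
    insertSum S (fun w => weaveSum E G (fun V T => φ w V T)) zs as =
      weaveSum E G (fun V T => insertSum S (fun w => φ w V T) zs as) :=
  (isFormalSum_insertSum S zs as).swap (isFormalSum_weaveSum E G) (fun w p => φ w p.1 p.2)

/-- Weaving only regroups operations, so the total degree of `V ++ T` is constant over the sum and
signs depending on it can be pulled out. -/
lemma weaveSum_congr {E : List (Cochain 𝒵 𝒜)} {G : List (Op 𝒵 𝒜 μ)}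
    {φ ψ : List (Op 𝒵 𝒜 μ) → List (Op 𝒵 𝒜 μ) → M}
    (h : ∀ V T, degs V + degs T = degs E + degs G → φ V T = ψ V T) :
    weaveSum E G φ = weaveSum E G ψ := by
  induction E generalizing G φ ψ with
  | nil => exact h _ _ (by simp)
  | cons E S ih =>
    refine cutSum_congr fun G₀ G' h1 => cutSum_congr fun G₁ G₂ h2 => ?_
    rw [ih fun V T hVT => h _ _ ?_]
    simp only [degs_append, degs_cons, brace_deg, ← h1, ← h2] at hVT ⊢
    omega

/-- Successive insertions. -/
theorem composeSum_eq_weaveSum (E : List (Cochain 𝒵 𝒜)) (G : List (Op 𝒵 𝒜 μ))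
    {f : AWord 𝒜 Unit → M} (hf : LetterAdditive f) (zs : ZWord 𝒵) (as : AWord 𝒜 μ) :
    composeSum E G f zs as = weaveSum E G (fun V T => insertSum (V ++ T) f zs as) := by
  induction E generalizing G f zs as with
  | nil =>
    rw [composeSum, unshuffleSum_nil_left (by simp)]
    simp [weaveSum]
  | cons E S ih =>
    rw [composeSum_cons, weaveSum]
    refine cutSum_congr fun G₀ G' hG => ?_
    -- `G` is now divided into `G₀`, lying before `E`, then `G₁`, absorbed by `E`, and `G₂`, to
    -- which the induction hypothesis applies.
    have h1 : ∀ w Z J, composeHead E S G' (fun x => f (w ++ x)) Z J = _ := fun w Z J =>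
      composeHead_eq E S G' (hf.append w) Z J
    have h2 : ∀ w (G₁ : List (Op 𝒵 𝒜 μ)) G₂ L (K : AWord 𝒜 μ) R T, composeSum S G₂ (fun x => f (w ++ (brace E G₁).out L K :: x)) R T
        = _ := fun w G₁ G₂ L K R T => ih G₂ ((hf.append w).cons _) R T
    simp only [h1, h2, insertSum_cutSum_swap, insertSum_splitSum_swap, insertSum_smul,
      insertSum_weaveSum_swap, ← cutSum_smul, splitSum_cutSum_swap]
    refine cutSum_congr fun G₁ G₂ hG' => ?_
    -- On the weave side, the insertion is cut around the operation `brace E G₁`, which isolates the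
    -- same blocks of inputs.
    simp only [List.append_assoc, List.cons_append, insertSum_append_cons, weaveSum_splitSum_swap,
      ← splitSum_smul]
    refine splitSum_congr fun L₀ I R₀ J h3 h4 => splitSum_congr fun L K R T h5 h6 => ?_
    rw [← weaveSum_smul, ← weaveSum_smul, ← weaveSum_smul]
    refine weaveSum_congr fun V T' hV => ?_
    simp only [smul_smul, ← Int.negOnePow_add]
    congr 1
    apply negOnePow_congr
    rw [degs_append, hV, ← hG', degs_append, brace_deg]
    push_cast; grind

/-! ### The brace relation -/

/-- The `z`'s are divided among `D`, the `E`'s and the `G`'s. For a fixed block kept by `D`,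
coassociativity collects the remainder into a `composeSum`, which is a sum over weaves. The
operations `G` may see labels, so the list may contain `anchor`. -/
theorem brace_brace [DirectSum.Decomposition 𝒜] (D : Cochain 𝒵 𝒜) (E : List (Cochain 𝒵 𝒜))
    (G : List (Op 𝒵 𝒜 μ)) (zs : ZWord 𝒵) (as : AWord 𝒜 μ) :
    (brace (brace D E) G).toFun zs as =
      weaveSum E G (fun V T => (brace D (V ++ T)).toFun zs as) := by
  have h (L : ZWord 𝒵) : (brace D E).toFun L = fun w => unshuffleSum (fun L₀ P =>
      (wt L₀ * degs E).negOnePow • insertSum E (D.toFun L₀) P w) L :=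
    funext fun w => brace_toFun D E L w
  rw [brace_toFun]
  simp only [h, brace_toFun, weaveSum_unshuffleSum_swap, insertSum_unshuffleSum_swap,
    ← unshuffleSum_smul, insertSum_smul]
  trans unshuffleSum (fun L R => unshuffleSum (fun L₀ P => ((wt L₀ + wt P) * degs G +
    wt L₀ * degs E).negOnePow • insertSum G (fun w => insertSum E (D.toFun L₀) P w) R as) L) zs
  · refine unshuffleSum_congr (fun L R => unshuffleSum_congr_of fun L₀ P h _ => ?_) zs
    rw [smul_smul, ← Int.negOnePow_add, h]
  rw [← unshuffleSum_assoc (fun L₀ P R => ((wt L₀ + wt P) * degs G +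
    wt L₀ * degs E).negOnePow • insertSum G (fun w => insertSum E (D.toFun L₀) P w) R as)]
  refine unshuffleSum_congr (M := A) (fun L₀ X => ?_) zs
  trans (wt L₀ * (degs E + degs G)).negOnePow • composeSum E G (D.toFun L₀) X as
  · rw [composeSum, ← unshuffleSum_smul]
    refine unshuffleSum_congr (fun P R => ?_) X
    rw [smul_smul, ← Int.negOnePow_add]
    congr 2
    ring
  · rw [composeSum_eq_weaveSum E G (letterAdditive_toFun D L₀), ← weaveSum_smul]
    refine weaveSum_congr fun V T h => ?_
    rw [degs_append, h]

/-! ### Labels -/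

lemma Op.eq_of {E F : Op 𝒵 𝒜 μ} (h : E.deg = F.deg) (h' : ∀ zs as, E.toFun zs as = F.toFun zs as) :
    E = F := by
  cases E; cases F
  obtain rfl := h
  obtain rfl := funext fun zs => funext (h' zs)
  rfl

@[simp] lemma degs_map_lift (S : List (Cochain 𝒵 𝒜)) :
    degs (S.map (fun E => E.lift μ)) = degs S := by
  simp [degs, Function.comp_def, Op.lift]

lemma Op.lift_out (E : Cochain 𝒵 𝒜) (L : ZWord 𝒵) (K : AWord 𝒜 μ) :
    (E.lift μ).out L K = E.out L (K.map (Letter.relabel ())) :=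
  Letter.ext (by simp [Op.lift]) rfl rfl

lemma splitSum_map (g : ν)
    (f : ZWord 𝒵 → AWord 𝒜 ν → ZWord 𝒵 → AWord 𝒜 ν → M) (zs : ZWord 𝒵) (as : AWord 𝒜 μ) :
    splitSum f zs (as.map (Letter.relabel g)) =
      splitSum (fun L I R J => f L (I.map (Letter.relabel g)) R (J.map (Letter.relabel g))) zs as := by
  simp only [splitSum, cutSum_map, wt_relabel]

lemma relabel_relabel (g : ν) (as : AWord 𝒜 μ) :
    (as.map (Letter.relabel g)).map (Letter.relabel ()) = as.map (Letter.relabel ()) := by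
  simp [Function.comp_def, Letter.relabel]

lemma insertSum_lift (S : List (Cochain 𝒵 𝒜)) (f : AWord 𝒜 Unit → M) (zs : ZWord 𝒵)
    (as : AWord 𝒜 μ) :
    insertSum (S.map (fun E => E.lift μ)) f zs as = insertSum S f zs (as.map (Letter.relabel ())) := by
  induction S generalizing f zs as with
  | nil => cases zs <;> simp [-List.map_map, relabel_relabel]
  | cons E S ih =>
    simp only [List.map_cons, insertSum, cutSum_map, splitSum_map, wt_relabel, degs_map_lift, ih,
      relabel_relabel, Op.lift_out]
    rfl

lemma lift_brace (E : Cochain 𝒵 𝒜) (S : List (Cochain 𝒵 𝒜)) :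
    (brace E S).lift μ = brace E (S.map (fun E => E.lift μ)) := by
  refine Op.eq_of ?_ fun zs as => ?_
  · rw [brace_deg, degs_map_lift]; rfl
  · rw [brace_toFun]
    simp only [insertSum_lift, degs_map_lift]
    exact brace_toFun E S zs _

lemma brace_nil (E : Cochain 𝒵 𝒜) : brace E ([] : List (Op 𝒵 𝒜 μ)) = E.lift μ := by
  refine Op.eq_of (by simp [brace_deg, Op.lift]) fun zs as => ?_
  rw [brace_toFun, unshuffleSum_nil_right (by simp)]
  simp [Op.lift]

/-! ### The distinguished input -/

lemma LetterAdditive.apply_zero {f : AWord 𝒜 Unit → M} (hf : LetterAdditive f)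
    (l r : AWord 𝒜 Unit) (a : Letter 𝒜 Unit) (ha : a.val = 0) : f (l ++ a :: r) = 0 := by
  revert ha
  obtain ⟨d, x, hx, -⟩ := a
  intro ha
  obtain rfl : x = 0 := ha
  obtain ⟨φ, hφ⟩ := hf l r d
  rw [hφ, map_zero]

/-- A sum over factorizations `I K T` of a word with a single marked letter, of a function which
vanishes unless `K` consists of one marked letter. -/
lemma cutSum_cutSum_marked (g : AWord 𝒜 Bool → AWord 𝒜 Bool → AWord 𝒜 Bool → M)
    (hg : ∀ I K T, (∀ b : Letter 𝒜 Bool, b.mark = true → K ≠ [b]) → g I K T = 0)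
    (u v : AWord 𝒜 Bool) (a : Letter 𝒜 Bool) (hu : ∀ b ∈ u, b.mark = false)
    (hv : ∀ b ∈ v, b.mark = false) :
    cutSum (fun I J => cutSum (fun K T => g I K T) J) (u ++ a :: v) = g u [a] v := by
  induction u generalizing g with
  | nil =>
    rw [List.nil_append, cutSum_cons, cutSum_cons, cutSum_nil_left, hg [] [] _ (by simp), zero_add]
    · rw [cutSum_congr (g := fun _ _ => 0), cutSum_zero, add_zero]
      intro I J hIJ
      rw [cutSum_congr (g := fun _ _ => 0), cutSum_zero]
      rintro K T rfl
      refine hg _ _ _ ?_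
      rintro b hb rfl
      have := hv b (by simp [← hIJ])
      simp_all
    · intro b u v
      exact hg _ _ _ (by simp)
  | cons b u ih =>
    rw [List.cons_append, cutSum_cons, cutSum_cons, hg [] [] _ (by simp),
      cutSum_congr (g := fun _ _ => 0), cutSum_zero, zero_add, zero_add,
      ih (fun I K T => g (b :: I) K T) (fun I K T h => hg _ _ _ h)
        (fun c hc => hu c (List.mem_cons_of_mem _ hc))]
    intro K T _
    refine hg _ _ _ fun c hc h => ?_
    have := hu b (by simp)
    simp_all

lemma degs_anchored (S S' : List (Cochain 𝒵 𝒜)) : degs (anchored S S') = degs S + degs S' := by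
  simp [anchored, anchor]

/-- The anchor vanishes unless it receives no `z` and exactly the marked letter. One placement of it
survives: `a` becomes a direct letter, `S` acts on `u` and `S'` on `v`. This is the condition on the
terms of `X_r` in a cyclic brace. -/
lemma insertSum_anchored (S S' : List (Cochain 𝒵 𝒜)) {f : AWord 𝒜 Unit → M}
    (hf : LetterAdditive f) (zs : ZWord 𝒵) (u v : AWord 𝒜 Unit) (a : Letter 𝒜 Unit) :
    insertSum (anchored S S') f zs
        (u.map (Letter.relabel false) ++ a.relabel true :: v.map (Letter.relabel false)) =
      unshuffleSum (fun L R =>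
        (wt R * (wt u + a.deg) + degs S' * (wt L + wt u + a.deg)).negOnePow •
          insertSum S (fun w => insertSum S' (fun x => f (w ++ a :: x)) R v) L u) zs := by
  rw [anchored, insertSum_append_cons, splitSum]
  refine unshuffleSum_congr (fun L₀ R₀ => ?_) zs
  have h0 : ∀ (L : ZWord 𝒵) (K : AWord 𝒜 Bool) (w x : AWord 𝒜 Unit),
      (anchor : Op 𝒵 𝒜 Bool).toFun L K = 0 → f (w ++ anchor.out L K :: x) = 0 :=
    fun L K w x h => hf.apply_zero w x _ h
  have h1 : ∀ (z : Letter 𝒵 Unit) (L : ZWord 𝒵) (K : AWord 𝒜 Bool) (w x : AWord 𝒜 Unit),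
      f (w ++ anchor.out (z :: L) K :: x) = 0 := fun z L K w x => h0 _ _ _ _ rfl
  have h2 : ∀ (I K T : AWord 𝒜 Bool), (∀ b : Letter 𝒜 Bool, b.mark = true → K ≠ [b]) →
      ∀ w x, f (w ++ (anchor : Op 𝒵 𝒜 Bool).out [] K :: x) = 0 := by
    intro I K T hK w x
    refine h0 _ _ _ _ ?_
    match K, hK with
    | [], _ => rfl
    | [b], hK =>
      have hb : b.mark ≠ true := fun h => hK b h rfl
      simp [anchor, hb]
    | _ :: _ :: _, _ => rfl
  have h5 (I J : AWord 𝒜 Bool) := splitSum_nil_left (zs := R₀) (as := J) (f := fun L K R T =>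
    (((anchor : Op 𝒵 𝒜 Bool).deg + degs (List.map (fun E => Op.lift E Bool) S')) * (wt L₀ + wt I) +
      degs (List.map (fun E => Op.lift E Bool) S') * (wt L + wt K)).negOnePow •
    insertSum (List.map (fun E => Op.lift E Bool) S) (fun w => insertSum
      (List.map (fun E => Op.lift E Bool) S') (fun x => f (w ++ anchor.out L K :: x)) R T) L₀ I)
    (by intro z L I R J; simp only [h1, insertSum_zero, smul_zero])
  simp only [h5, ← cutSum_smul]
  -- Among all choices of the block given to the anchor, only the factorization around the marked
  -- letter remains.
  rw [cutSum_cutSum_marked (fun I K T => (wt R₀ * wt I).negOnePow • (wt R₀ * wt K).negOnePow •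
    (((anchor : Op 𝒵 𝒜 Bool).deg + degs (List.map (fun E => Op.lift E Bool) S')) * (wt L₀ + wt I) +
      degs (List.map (fun E => Op.lift E Bool) S') * (wt [] + wt K)).negOnePow •
    insertSum (List.map (fun E => Op.lift E Bool) S) (fun w => insertSum
      (List.map (fun E => Op.lift E Bool) S') (fun x => f (w ++ anchor.out [] K :: x)) R₀ T) L₀ I)]
  · have h3 : (anchor : Op 𝒵 𝒜 Bool).out [] [a.relabel true] = a :=
      Letter.ext (by simp [anchor, Letter.relabel]) (by simp [anchor, Op.out, Letter.relabel]) rfl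
    simp only [h3, insertSum_lift, relabel_relabel, map_relabel_unit, smul_smul,
      ← Int.negOnePow_add, wt_relabel, degs_map_lift]
    congr 1
    apply negOnePow_congr
    have h4 : (anchor : Op 𝒵 𝒜 Bool).deg = 0 := rfl
    simp only [wt_cons, wt_nil, h4, Letter.relabel]
    push_cast; grind
  · intro I K T hK
    simp only [h2 I K T hK, insertSum_zero, smul_zero]
  · simp [Letter.relabel]
  · simp [Letter.relabel]

/-! ### Cyclic braces -/

section cyclic

variable (ω : NondegForm 𝒜) (one : 𝒜 (-1))

/-- The linear form `ω(·, b)`. -/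
def NondegForm.pair (b : A) : A →+ 𝕜 := (ω.form.flip b).toAddMonoidHom

lemma NondegForm.pair_apply (b x : A) : ω.pair b x = ω.form x b := rfl

lemma cyclicSum_brace_anchored [DirectSum.Decomposition 𝒜] (D : Cochain 𝒵 𝒜) (S S' : List (Cochain 𝒵 𝒜)) (zs : ZWord 𝒵)
    (as : AWord 𝒜 Unit) (a : Letter 𝒜 Unit) :
    cyclicSum ω one (brace D (anchored S S')) zs as a =
      cutSum (fun v u => unshuffleSum (fun L₀ X => unshuffleSum (fun L R =>
        (wt v * (wt u + a.deg) + wt L₀ * (degs S + degs S') + wt R * (wt u + a.deg) +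
          degs S' * (wt L + wt u + a.deg)).negOnePow •
        insertSum S (fun w => insertSum S' (fun x => ω.pair one (D.toFun L₀ (w ++ a :: x))) R v)
          L u) X) zs) as := by
  unfold cyclicSum
  refine cutSum_congr fun v u _ => ?_
  rw [← NondegForm.pair_apply, brace_toFun, map_unshuffleSum, ← unshuffleSum_smul]
  refine unshuffleSum_congr (fun L₀ X => ?_) zs
  rw [map_negOnePow_smul, map_insertSum, insertSum_anchored S S'
    ((letterAdditive_toFun D L₀).comp (ω.pair one)), ← unshuffleSum_smul, ← unshuffleSum_smul]
  refine unshuffleSum_congr (fun L R => ?_) X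
  simp only [smul_smul, ← Int.negOnePow_add, degs_anchored]
  congr 2
  ring

/-- With no operations after the anchor, no `z` can be used to its right and the letters of `v`
reach `D` unchanged. -/
lemma cyclicSum_brace_anchored_nil [DirectSum.Decomposition 𝒜] (D : Cochain 𝒵 𝒜) (S : List (Cochain 𝒵 𝒜)) (zs : ZWord 𝒵)
    (as : AWord 𝒜 Unit) (a : Letter 𝒜 Unit) :
    cyclicSum ω one (brace D (anchored S [])) zs as a =
      cutSum (fun v u => unshuffleSum (fun L₀ P =>
        (wt v * (wt u + a.deg) + wt L₀ * degs S).negOnePow •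
        insertSum S (fun w => ω.pair one (D.toFun L₀ (w ++ a :: v))) P u) zs) as := by
  rw [cyclicSum_brace_anchored]
  refine cutSum_congr fun v u _ => unshuffleSum_congr (fun L₀ X => ?_) zs
  rw [unshuffleSum_nil_right (by simp)]
  simp

/-- The case of no inputs is excluded because `cyc` is set to zero there, although the cyclic sum
need not vanish. -/
lemma form_cyc (G : Op 𝒵 𝒜 Bool) (zs : ZWord 𝒵) (as : AWord 𝒜 Unit) (h : zs ≠ [] ∨ as ≠ [])
    (a : Letter 𝒜 Unit) :
    ω.form ((cyc ω one G).toFun zs as) a.val = cyclicSum ω one G zs as a := by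
  rw [← form_cycVal]
  cases zs <;> cases as <;> first | rfl | simp at h

lemma NondegForm.eq_of_form {x y : A} {d : ℤ} (hx : x ∈ 𝒜 d) (hy : y ∈ 𝒜 d)
    (h : ∀ a : Letter 𝒜 Unit, ω.form x a.val = ω.form y a.val) : x = y := by
  have := (ω.nondegenerate d (-d - ω.deg) (by ring)).1 (a₁ := ⟨x, hx⟩) (a₂ := ⟨y, hy⟩)
    (LinearMap.ext fun a => h ⟨_, a.1, a.2, ()⟩)
  exact congrArg Subtype.val this

end cyclic

/-! ### Cyclic brace relations in terms of lists -/

/-- Puts a sum over weaves in a single graded piece, as is needed to test equality against `ω`. -/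
lemma weaveSum_mem {p : Submodule 𝕜 A} {E : List (Cochain 𝒵 𝒜)} {G : List (Op 𝒵 𝒜 μ)}
    {φ : List (Op 𝒵 𝒜 μ) → List (Op 𝒵 𝒜 μ) → A}
    (h : ∀ V T, degs V + degs T = degs E + degs G → φ V T ∈ p) : weaveSum E G φ ∈ p := by
  induction E generalizing G φ with
  | nil => exact h _ _ (by simp)
  | cons E S ih =>
    refine cutSum_mem _ fun G₀ G' h1 => cutSum_mem _ fun G₁ G₂ h2 => ?_
    rw [Units.smul_def]
    refine zsmul_mem (ih fun V T hVT => h _ _ ?_) _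
    simp only [degs_append, degs_cons, brace_deg, ← h1, ← h2] at hVT ⊢
    omega

section relations

variable [DirectSum.Decomposition 𝒜] (ω : NondegForm 𝒜) (one : 𝒜 (-1))

/-- Cyclization of the brace relation. -/
theorem cyc_brace_brace (D : Cochain 𝒵 𝒜) (E : List (Cochain 𝒵 𝒜)) (G : List (Op 𝒵 𝒜 Bool))
    (zs : ZWord 𝒵) (as : AWord 𝒜 Unit) :
    (cyc ω one (brace (brace D E) G)).toFun zs as =
      weaveSum E G (fun V T => (cyc ω one (brace D (V ++ T))).toFun zs as) := by
  by_cases h : zs ≠ [] ∨ as ≠ []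
  · refine ω.eq_of_form ((cyc ω one (brace (brace D E) G)).mem zs as) (weaveSum_mem fun V T hVT => ?_)
      fun a => ?_
    · have := (cyc ω one (brace D (V ++ T))).mem zs as
      convert this using 4
      simp only [cyc, brace_deg, degs_append]
      omega
    · rw [form_cyc _ _ _ _ _ h, ← NondegForm.pair_apply, map_weaveSum]
      -- In each rotation the labelled word is the same for all terms, so the ordinary brace
      -- relation applies rotation by rotation.
      simp only [NondegForm.pair_apply, form_cyc _ _ _ _ _ h, cyclicSum, brace_brace,
        weaveSum_cutSum_swap, weaveSum_smul]
      refine cutSum_congr fun v u _ => ?_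
      rw [← NondegForm.pair_apply, map_weaveSum]
      rfl
  · obtain ⟨rfl, rfl⟩ : zs = [] ∧ as = [] := by simpa using h
    simp only [Op.nil, weaveSum_zero]

/-- The relation between a first-order cyclic brace and an ordinary brace. -/
theorem brace_brace₁ (D : Cochain 𝒵 𝒜) (E F : List (Cochain 𝒵 𝒜))
    (zs : ZWord 𝒵) (as : AWord 𝒜 Unit) :
    (brace (brace₁ ω one D E []) F).toFun zs as =
      cutSum (fun F₁ F₂ => (degs F₁ * degs F₂).negOnePow •
        weaveSum E F₂ (fun V T => (brace₁ ω one D (V ++ T) F₁).toFun zs as)) F := by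
  by_cases hne : zs ≠ [] ∨ as ≠ []
  swap
  · obtain ⟨rfl, rfl⟩ : zs = [] ∧ as = [] := by simpa using hne
    simp only [Op.nil, weaveSum_zero, smul_zero, cutSum_zero]
  refine ω.eq_of_form ((brace (brace₁ ω one D E []) F).mem zs as) (cutSum_mem _ fun F₁ F₂ hF => ?_)
    fun a => ?_
  · rw [Units.smul_def]
    refine zsmul_mem (weaveSum_mem fun V T hVT => ?_) _
    have := (brace₁ ω one D (V ++ T) F₁).mem zs as
    convert this using 4
    simp only [brace₁, cyc, brace_deg, degs_append, degs_anchored, ← hF, degs_nil]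
    omega
  -- The common summand after pairing with `a`: `F₁` builds from `(R₁, I)` the word `v` to the right
  -- of `a`, `F₂` builds from `(R₂, J)` the word into which the `E`'s are inserted, and the result
  -- stands to the left of `a`.
  let c : List (Cochain 𝒵 𝒜) → List (Cochain 𝒵 𝒜) → ZWord 𝒵 → ZWord 𝒵 → ZWord 𝒵 → ZWord 𝒵 →
      AWord 𝒜 Unit → AWord 𝒜 Unit → 𝕜 := fun F₁ F₂ L₀ P R₁ R₂ I J =>
    insertSum F₁ (fun v => insertSum F₂ (fun u => insertSum E (fun w =>
      ω.pair one (D.toFun L₀ (w ++ a :: v))) P u) R₂ J) R₁ I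
  simp only [← NondegForm.pair_apply, map_cutSum, map_weaveSum, map_negOnePow_smul]
  trans cutSum (fun F₁ F₂ => unshuffleSum (fun L₀ X => unshuffleSum (fun R₁ Y =>
    unshuffleSum (fun P R₂ => cutSum (fun I J =>
      (degs F₁ * degs F₂ + wt I * (wt J + a.deg) + wt L₀ * (degs E + degs F₂ + degs F₁) +
        wt R₁ * (wt J + a.deg) + degs F₁ * (wt P + wt R₂ + wt J + a.deg) +
        (wt P + wt R₂) * wt R₁ + degs F₂ * wt P).negOnePow • c F₁ F₂ L₀ P R₁ R₂ I J)
      as) Y) X) zs) F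
  · rw [brace_toFun, map_unshuffleSum, ← unshuffleSum_cutSum_swap]
    simp only [← unshuffleSum_cutSum_swap]
    -- The cyclization is expanded at the word produced by the `F`s, so it is this word, and not
    -- `as`, that gets cut and rotated.
    trans unshuffleSum (fun L R => (wt L * degs F).negOnePow • insertSum F (fun w =>
      cutSum (fun v u => unshuffleSum (fun L₀ P =>
        (wt v * (wt u + a.deg) + wt L₀ * degs E).negOnePow • insertSum E (fun w =>
          ω.pair one (D.toFun L₀ (w ++ a :: v))) P u) L) w) R as) zs
    · refine unshuffleSum_congr_of fun L R h1 h2 => ?_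
      rw [map_negOnePow_smul, map_insertSum]
      congr 1
      simp only [← cyclicSum_brace_anchored_nil]
      by_cases hFas : F ≠ [] ∨ as ≠ []
      · exact insertSum_congr_of_ne_nil hFas fun w hw => form_cyc _ _ _ _ _ (.inr hw) _
      · obtain ⟨rfl, rfl⟩ : F = [] ∧ as = [] := by simpa using hFas
        -- Without `F`'s and `a`'s the insertion vanishes unless `R` is empty. Then `L` has the
        -- length of `zs`, which is nonzero by `hne`, so the defining equation of `cyc` is
        -- available.
        cases R with
        | nil =>
          refine form_cyc _ _ _ _ _ (.inl ?_) _
          rintro rfl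
          have : zs = [] := List.eq_nil_of_length_eq_zero (by simpa using h2.symm)
          simp [this] at hne
        | cons z R => rfl
    · have hL₀ (g : ZWord 𝒵 → ZWord 𝒵 → ZWord 𝒵 → ZWord 𝒵 → 𝕜) :
          unshuffleSum (fun L R => unshuffleSum (fun L₀ P => unshuffleSum (fun R₁ R₂ =>
            g L₀ P R₁ R₂) R) L) zs = unshuffleSum (fun L₀ X => unshuffleSum (fun R₁ Y =>
            unshuffleSum (fun P R₂ => (wt P * wt R₁).negOnePow • g L₀ P R₁ R₂) Y) X) zs := by
        rw [← unshuffleSum_assoc (fun L₀ P R => unshuffleSum (fun R₁ R₂ => g L₀ P R₁ R₂) R)]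
        exact unshuffleSum_congr (fun L₀ X => unshuffleSum_left_comm _ _) zs
      trans unshuffleSum (fun L R => unshuffleSum (fun L₀ P => unshuffleSum (fun R₁ R₂ =>
        cutSum (fun F₁ F₂ => cutSum (fun I J =>
          ((wt L₀ + wt P) * (degs F₁ + degs F₂) + wt R₂ * wt I + degs F₂ * (wt R₁ + wt I) +
            (degs F₁ + wt R₁ + wt I) * (degs F₂ + wt R₂ + wt J + a.deg) +
            wt L₀ * degs E).negOnePow • c F₁ F₂ L₀ P R₁ R₂ I J) as) F) R) L) zs
      · refine unshuffleSum_congr (fun L R => ?_) zs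
        -- Cutting the word made by the `F`s as `v u` divides them into `F₁`, which makes `v`, and
        -- `F₂`, which makes `u`. The weights of `v` and `u` are fixed, so the rotation sign can be
        -- taken out in `h3`.
        simp only [insertSum_cutSum, insertSum_unshuffleSum_swap, ← cutSum_smul,
          ← unshuffleSum_smul, ← unshuffleSum_cutSum_swap]
        refine unshuffleSum_congr_of fun L₀ P h1 _ => ?_
        simp only [splitSum, ← unshuffleSum_smul, ← unshuffleSum_cutSum_swap]
        refine unshuffleSum_congr (fun R₁ R₂ => cutSum_congr fun F₁ F₂ hF => ?_) R
        simp only [← cutSum_smul]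
        refine cutSum_congr fun I J _ => ?_
        have h3 : insertSum F₁ (fun v => insertSum F₂ (fun u =>
            (wt v * (wt u + a.deg) + wt L₀ * degs E).negOnePow • insertSum E (fun w =>
              ω.pair one (D.toFun L₀ (w ++ a :: v))) P u) R₂ J) R₁ I =
            ((degs F₁ + wt R₁ + wt I) * (degs F₂ + wt R₂ + wt J + a.deg) +
              wt L₀ * degs E).negOnePow • c F₁ F₂ L₀ P R₁ R₂ I J := by
          rw [← insertSum_smul]
          refine insertSum_congr fun v hv => ?_
          rw [← insertSum_smul]
          refine insertSum_congr fun u hu => ?_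
          rw [hv, hu]
        rw [h3]
        simp only [smul_smul, ← Int.negOnePow_add]
        congr 1
        apply negOnePow_congr
        rw [← h1, ← hF, degs_append]
        push_cast; grind
      · rw [hL₀ (fun L₀ P R₁ R₂ => cutSum (fun F₁ F₂ => cutSum (fun I J =>
          ((wt L₀ + wt P) * (degs F₁ + degs F₂) + wt R₂ * wt I + degs F₂ * (wt R₁ + wt I) +
            (degs F₁ + wt R₁ + wt I) * (degs F₂ + wt R₂ + wt J + a.deg) +
            wt L₀ * degs E).negOnePow • c F₁ F₂ L₀ P R₁ R₂ I J) as) F)]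
        simp only [← cutSum_smul]
        refine unshuffleSum_congr (fun L₀ X => unshuffleSum_congr (fun R₁ Y =>
          unshuffleSum_congr (fun P R₂ => cutSum_congr fun F₁ F₂ hF =>
            cutSum_congr fun I J _ => ?_) Y) X) zs
        simp only [smul_smul, ← Int.negOnePow_add]
        congr 1
        apply negOnePow_congr
        push_cast; grind
  · refine cutSum_congr fun F₁ F₂ hF => ?_
    have h1 (V : List (Cochain 𝒵 𝒜)) : ω.pair a.val ((brace₁ ω one D V F₁).toFun zs as) = _ :=
      (form_cyc ω one (brace D (anchored V F₁)) zs as hne a).trans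
        (cyclicSum_brace_anchored ω one D V F₁ zs as a)
    simp only [h1, weaveSum_cutSum_swap, weaveSum_unshuffleSum_swap, ← cutSum_smul,
      ← unshuffleSum_smul, ← unshuffleSum_cutSum_swap]
    refine unshuffleSum_congr (fun L₀ X => ?_) zs
    -- On this side the `z`'s to the left of `a` come first; they are exchanged with those of `F₁`
    -- to match the other side.
    conv_rhs => rw [unshuffleSum_comm]
    refine unshuffleSum_congr (fun R₁ Y => ?_) X
    simp only [unshuffleSum_cutSum_swap, ← cutSum_smul]
    refine cutSum_congr fun I J _ => ?_
    trans (degs F₁ * degs F₂ + wt I * (wt J + a.deg) + wt L₀ * (degs E + degs F₂ + degs F₁) +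
        wt R₁ * (wt J + a.deg) + degs F₁ * (wt Y + wt J + a.deg) + wt Y * wt R₁).negOnePow •
      insertSum F₁ (fun v => composeSum E F₂ (fun w => ω.pair one (D.toFun L₀ (w ++ a :: v))) Y J)
        R₁ I
    · simp only [composeSum, insertSum_unshuffleSum_swap, insertSum_smul, ← unshuffleSum_smul]
      refine unshuffleSum_congr_of fun P R₂ h _ => ?_
      simp only [smul_smul, ← Int.negOnePow_add]
      congr 2
      rw [← h]
    -- For fixed `v`, everything to the left of `a` is a composite insertion of `E` into words made
    -- by `F₂`, hence a sum over weaves.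
    · have h2 (v : AWord 𝒜 Unit) := composeSum_eq_weaveSum E F₂
        (((letterAdditive_toFun D L₀).append_right (a :: v)).comp (ω.pair one)) Y J
      simp only [h2, insertSum_weaveSum_swap, ← weaveSum_smul]
      refine weaveSum_congr fun V T hVT => ?_
      rw [insertSum_insertSum_swap]
      simp only [smul_smul, ← Int.negOnePow_add]
      congr 1
      apply negOnePow_congr
      rw [degs_append, hVT]
      push_cast; grind

end relations

/-! ### Weaving in a final place-holder -/

/-- `f` applied to the head and the tail of a list, zero for the empty list. -/
def headSum {α : Type*} (f : α → List α → M) : List α → M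
  | [] => 0
  | a :: l => f a l

@[simp] lemma headSum_nil {α : Type*} (f : α → List α → M) : headSum f [] = 0 := rfl

@[simp] lemma headSum_cons {α : Type*} (f : α → List α → M) (a : α) (l : List α) :
    headSum f (a :: l) = f a l := rfl

lemma headSum_cutSum_swap {α β : Type*} (f : α → List α → List β → List β → M) (as : List α)
    (bs : List β) :
    headSum (fun a l => cutSum (fun u v => f a l u v) bs) as =
      cutSum (fun u v => headSum (fun a l => f a l u v) as) bs := by
  cases as <;> simp

lemma headSum_smul {α : Type*} (n : ℤˣ) (f : α → List α → M) (as : List α) :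
    headSum (fun a l => n • f a l) as = n • headSum f as := by
  cases as <;> simp

lemma headSum_congr {α : Type*} {f g : α → List α → M} {as : List α}
    (h : ∀ a l, a :: l = as → f a l = g a l) : headSum f as = headSum g as := by
  cases as with
  | nil => rfl
  | cons a as => exact h a as rfl

/-- With nothing left to insert, each `E_k` receives an empty brace. This describes the operations
`E` that come after the one absorbing, or standing to the right of, the last inserted operation. -/
lemma weaveSum_nil_right (E : List (Cochain 𝒵 𝒜)) (φ : List (Op 𝒵 𝒜 μ) → List (Op 𝒵 𝒜 μ) → M) :
    weaveSum E [] φ = φ (E.map (fun E => E.lift μ)) [] := by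
  induction E generalizing φ with
  | nil => rfl
  | cons E S ih => simp [weaveSum, ih, brace_nil]

lemma weaveSum_map_lift (E G : List (Cochain 𝒵 𝒜))
    (φ : List (Op 𝒵 𝒜 μ) → List (Op 𝒵 𝒜 μ) → M) :
    weaveSum E (G.map (fun E => E.lift μ)) φ =
      weaveSum E G (fun V T => φ (V.map (fun E => E.lift μ)) (T.map (fun E => E.lift μ))) := by
  induction E generalizing G φ with
  | nil => rfl
  | cons E S ih =>
    simp only [weaveSum, cutSum_map, ih, degs_map_lift, List.map_append, List.map_cons, lift_brace]

/-- The terms of a weave in which the last operation `x` is a direct argument, respectively is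
inserted into one of the operations `E`. -/
theorem weaveSum_append_singleton (E : List (Cochain 𝒵 𝒜)) (G : List (Op 𝒵 𝒜 μ)) (x : Op 𝒵 𝒜 μ)
    (hx : x.deg = 0) (φ : List (Op 𝒵 𝒜 μ) → M) :
    weaveSum E (G ++ [x]) (fun V T => φ (V ++ T)) =
      cutSum (fun E₁ E₂ => (degs E₂ * degs G).negOnePow • weaveSum E₁ G (fun V T =>
        φ (V ++ T ++ x :: E₂.map (fun E => E.lift μ)))) E +
      cutSum (fun E₁ E' => headSum (fun E₀ E₂ => (degs E₂ * degs G).negOnePow •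
        weaveSum E₁ G (fun V T => cutSum (fun T₁ T₂ =>
          (E₀.deg * (degs G - degs T₂)).negOnePow •
            φ (V ++ T₁ ++ brace E₀ (T₂ ++ [x]) :: E₂.map (fun E => E.lift μ))) T)) E') E := by
  induction E generalizing G φ with
  | nil => simp [weaveSum]
  | cons E S ih =>
    simp only [cutSum_cons (as := S), headSum_cons]
    simp only [weaveSum, cutSum_append_singleton, cutSum_nil, weaveSum_nil_right, List.append_nil]
    have h1 (G₀ G₁ G₂ : List (Op 𝒵 𝒜 μ)) := ih G₂ (fun W => φ (G₀ ++ brace E G₁ :: W))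
    simp only [List.append_assoc, List.cons_append] at h1 ⊢
    simp only [h1, smul_add, cutSum_add]
    -- The position of `x` relative to the first operation `E`: `p` direct and after `E`, `q` inside
    -- a later operation, `r` inside `E`, `s` direct and before `E`. The terms `s` and `r` are those
    -- with `E₁ = []` in the two sums. As `x` has degree `0`, it does not affect the signs.
    have h2 (p q r s : M) : p + q + r + s = s + p + (r + q) := by abel
    rw [h2]
    congr 1
    · congr 1
      · simp only [List.nil_append, brace_nil, List.map_cons]
        congr 2
        simp only [degs_append, degs_cons, degs_nil, hx]
        ring
      · simp only [← cutSum_smul]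
        simp only [cutSum_cutSum_swap _ S]
        refine cutSum_congr fun G₀ G' hG => cutSum_congr fun G₁ G₂ hG' => cutSum_congr
          fun S₁ S₂ hS => ?_
        simp only [smul_smul, ← Int.negOnePow_add]
        congr 2
        rw [← hG, ← hG', ← hS]
        simp only [degs_append]
        ring
    · congr 1
      · simp only [← cutSum_smul, List.nil_append]
        refine cutSum_congr fun G₀ G' hG => ?_
        rw [smul_smul, ← Int.negOnePow_add]
        congr 2
        simp only [degs_append, degs_cons, degs_nil, hx, ← hG]
        ring
      · simp only [← cutSum_smul, headSum_cutSum_swap, ← headSum_smul, cutSum_cutSum_swap _ S]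
        refine cutSum_congr fun G₀ G' hG => cutSum_congr fun G₁ G₂ hG' => cutSum_congr
          fun S₁ S' hS => headSum_congr fun E₀ S₂ hS' => ?_
        simp only [← weaveSum_smul]
        refine weaveSum_congr fun V T _ => ?_
        simp only [← cutSum_smul]
        refine cutSum_congr fun T₁ T₂ _ => ?_
        simp only [smul_smul, ← Int.negOnePow_add]
        congr 2
        rw [← hG, ← hG', ← hS, ← hS']
        simp only [degs_append, degs_cons]
        ring

/-! ### Weaves indexed by interlaced sequences -/

lemma seg_full {n : ℕ} (F : Fin n → Cochain 𝒵 𝒜) : seg F 0 n = List.ofFn F := by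
  rw [seg, List.take_of_length_le (by simp), List.drop_zero]

lemma seg_append {n : ℕ} (F : Fin n → Cochain 𝒵 𝒜) {a b c : ℕ} (hab : a ≤ b) (hbc : b ≤ c) :
    seg F a b ++ seg F b c = seg F a c := by
  simp only [seg]
  have h : (List.ofFn F).take b = ((List.ofFn F).take c).take b := by
    rw [List.take_take, min_eq_left hbc]
  have h' (l : List (Cochain 𝒵 𝒜)) : l.drop b = (l.drop a).drop (b - a) := by
    rw [List.drop_drop, Nat.add_sub_cancel' hab]
  rw [h, List.drop_take, h', List.take_append_drop]

lemma segDeg_eq_degs {n : ℕ} (F : Fin n → Cochain 𝒵 𝒜) (a b : ℕ) : segDeg F a b = degs (seg F a b) :=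
  rfl

lemma segDeg_add {n : ℕ} (F : Fin n → Cochain 𝒵 𝒜) {a b c : ℕ} (hab : a ≤ b) (hbc : b ≤ c) :
    segDeg F a b + segDeg F b c = segDeg F a c := by
  simp only [segDeg_eq_degs, ← seg_append F hab hbc, degs_append]

lemma cutSum_seg {n : ℕ} (F : Fin n → Cochain 𝒵 𝒜) {a : ℕ} (ha : a ≤ n)
    (f : List (Cochain 𝒵 𝒜) → List (Cochain 𝒵 𝒜) → M) :
    cutSum f (seg F a n) = ∑ i ∈ Finset.Icc a n, f (seg F a i) (seg F i n) := by
  rw [cutSum]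
  refine Finset.sum_bij' (fun k _ => a + k) (fun i _ => i - a) ?_ ?_ ?_ ?_ ?_
  · simp [seg]; omega
  · simp [seg]; omega
  · simp
  · intro i hi
    have := (Finset.mem_Icc.1 hi).1
    omega
  · intro k hk
    have hk' : a + k ≤ n := by simp [seg] at hk; omega
    have h1 : (seg F a n).take k = seg F a (a + k) := by
      rw [seg, seg, List.take_drop, List.take_take, min_eq_left hk']
    have h2 : (seg F a n).drop k = seg F (a + k) n := by
      rw [seg, seg, List.drop_drop]
    rw [h1, h2]

lemma sum_Icc_eq_sum_fin {n a : ℕ} (f : ℕ → M) :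
    ∑ i ∈ Finset.Icc a n, f i = ∑ i ∈ Finset.univ.filter (fun i : Fin (n + 1) => a ≤ (i : ℕ)), f i := by
  refine Finset.sum_bij' (fun i hi => ⟨i, by simp at hi; omega⟩) (fun i _ => i) ?_ ?_ ?_ ?_ ?_
  · intro i hi
    simpa using (Finset.mem_Icc.1 hi).1
  · simp; omega
  · simp
  · simp
  · simp

lemma ext₀_succ {n s : ℕ} (r : ℕ) (j : Fin (s + 1) → Fin (n + 1)) (k : Fin (s + 1)) :
    ext₀ r j k.succ = ext₀ (j 0) (Fin.tail j) k := by
  cases k using Fin.cases <;> rfl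

lemma ext₀_le {n s : ℕ} {r : ℕ} (hr : r ≤ n) (j : Fin s → Fin (n + 1)) (k : Fin (s + 1)) :
    ext₀ r j k ≤ n := by
  cases k using Fin.cases with
  | zero => exact hr
  | succ k => exact (j k).is_le

lemma mem_interlaced_succ {n r s : ℕ} (p : (Fin (s + 1) → Fin (n + 1)) × (Fin (s + 1) → Fin (n + 1))) :
    p ∈ interlaced n r (s + 1) ↔ r ≤ (p.1 0 : ℕ) ∧ (p.1 0 : ℕ) ≤ p.2 0 ∧
      (Fin.tail p.1, Fin.tail p.2) ∈ interlaced n (p.2 0) s := by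
  simp only [interlaced, Finset.mem_filter, Finset.mem_univ, true_and, Fin.forall_fin_succ,
    ← Fin.succ_castSucc, ext₀_succ, and_assoc]
  rfl

/-- After the first pair `(i₁, j₁)` is removed, the remaining sequences are interlaced with lower
bound `j₁`; this matches the recursion defining `weaveSum`. -/
lemma sum_interlaced_succ (n r s : ℕ)
    (h : (Fin (s + 1) → Fin (n + 1)) × (Fin (s + 1) → Fin (n + 1)) → M) :
    ∑ p ∈ interlaced n r (s + 1), h p =
      ∑ i ∈ Finset.univ.filter (fun i : Fin (n + 1) => r ≤ (i : ℕ)),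
        ∑ j ∈ Finset.univ.filter (fun j : Fin (n + 1) => (i : ℕ) ≤ (j : ℕ)), ∑ p ∈ interlaced n j s, h (Fin.cons i p.1, Fin.cons j p.2) := by
  simp only [Finset.sum_sigma']
  refine Finset.sum_bij' (fun p _ => ⟨p.1 0, p.2 0, Fin.tail p.1, Fin.tail p.2⟩)
    (fun x _ => (Fin.cons x.1 x.2.2.1, Fin.cons x.2.1 x.2.2.2)) ?_ ?_ ?_ ?_ ?_
  · intro p hp
    simpa [mem_interlaced_succ] using hp
  · rintro ⟨i, j, p⟩ hp
    simpa [mem_interlaced_succ] using hp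
  · intro p _
    simp
  · rintro ⟨i, j, p⟩ _
    simp
  · intro p _
    simp

lemma weave_succ {n s : ℕ} (r : ℕ) (E : Fin (s + 1) → Cochain 𝒵 𝒜) (F : Fin n → Cochain 𝒵 𝒜)
    (i j : Fin (s + 1) → Fin (n + 1)) :
    weave r E F i j = seg F r (i 0) ++ brace (E 0) (seg F (i 0) (j 0)) ::
      weave (j 0) (Fin.tail E) F (Fin.tail i) (Fin.tail j) := by
  simp only [weave, List.finRange_succ, List.flatMap_cons, List.flatMap_map, List.append_assoc,
    List.singleton_append, ← Fin.succ_castSucc, ext₀_succ]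
  rfl

lemma weaveSign_succ {n s : ℕ} {r : ℕ} (E : Fin (s + 1) → Cochain 𝒵 𝒜) (F : Fin n → Cochain 𝒵 𝒜)
    (i : Fin (s + 1) → Fin (n + 1)) :
    weaveSign r E F i = (E 0).deg * segDeg F r (i 0) + weaveSign r (Fin.tail E) F (Fin.tail i) := by
  simp [weaveSign, Fin.sum_univ_succ, Fin.tail]

/-- Signs are measured from `r`, but after one step of the recursion from `b = j₁`. Each remaining
`E_k` must also pass `F_{r+1}, …, F_b`, which accounts for the factor `degs S * (degs G₀ + degs G₁)`
in `weaveSum`. -/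
lemma weaveSign_shift {n s r b : ℕ} (hrb : r ≤ b) (E : Fin s → Cochain 𝒵 𝒜)
    (F : Fin n → Cochain 𝒵 𝒜) (i : Fin s → Fin (n + 1)) (hi : ∀ k, b ≤ (i k : ℕ)) :
    weaveSign r E F i = degs (List.ofFn E) * segDeg F r b + weaveSign b E F i := by
  simp only [weaveSign, degs, List.map_ofFn, List.sum_ofFn, Finset.sum_mul,
    ← Finset.sum_add_distrib, Function.comp]
  refine Finset.sum_congr rfl fun k _ => ?_
  rw [← segDeg_add F hrb (hi k), mul_add]

lemma le_of_mem_interlaced {n r s : ℕ} {p : (Fin s → Fin (n + 1)) × (Fin s → Fin (n + 1))}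
    (hp : p ∈ interlaced n r s) (k : Fin s) : r ≤ (p.1 k : ℕ) := by
  induction s generalizing r with
  | zero => exact k.elim0
  | succ s ih =>
    obtain ⟨h1, h2, h3⟩ := (mem_interlaced_succ p).1 hp
    cases k using Fin.cases with
    | zero => exact h1
    | succ k => exact h1.trans (h2.trans (ih h3 k))

/-- Translates the recursive sum into the indexed one: successive cuts of the list of `F`'s are the
positions `i₁, j₁, i₂, j₂, …`, and the tail `T` is what follows the last `j`. -/
theorem weaveSum_ofFn {m n : ℕ} (E : Fin m → Cochain 𝒵 𝒜) (F : Fin n → Cochain 𝒵 𝒜) {r : ℕ}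
    (hr : r ≤ n) (φ : List (Cochain 𝒵 𝒜) → List (Cochain 𝒵 𝒜) → M) :
    weaveSum (List.ofFn E) (seg F r n) φ = ∑ p ∈ interlaced n r m,
      (weaveSign r E F p.1).negOnePow •
        φ (weave r E F p.1 p.2) (seg F (ext₀ r p.2 (Fin.last m)) n) := by
  induction m generalizing r φ with
  | zero =>
    have h : interlaced n r 0 = Finset.univ := by simp [interlaced]
    rw [h, Fintype.sum_subsingleton _ (Fin.elim0, Fin.elim0)]
    simp [weaveSum, weaveSign, weave, ext₀]
  | succ m ih =>
    rw [List.ofFn_succ, weaveSum, cutSum_seg F hr, sum_Icc_eq_sum_fin (fun i => _),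
      sum_interlaced_succ]
    refine Finset.sum_congr rfl fun i hi => ?_
    rw [cutSum_seg F i.is_le, sum_Icc_eq_sum_fin (fun j => _)]
    refine Finset.sum_congr rfl fun j hj => ?_
    have hri : r ≤ (i : ℕ) := by simpa using hi
    have hij : (i : ℕ) ≤ j := by simpa using hj
    change _ • weaveSum (List.ofFn (Fin.tail E)) _ _ = _
    rw [ih (Fin.tail E) j.is_le, Finset.smul_sum]
    refine Finset.sum_congr rfl fun p hp => ?_
    rw [smul_smul, ← Int.negOnePow_add, weave_succ, weaveSign_succ, ← Fin.succ_last, ext₀_succ]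
    simp only [Fin.cons_zero, Fin.tail_cons]
    rw [weaveSign_shift (hri.trans hij) _ _ _ (le_of_mem_interlaced hp), ← segDeg_add F hri hij]
    congr 2
    simp only [segDeg_eq_degs]
    change _ + degs (List.ofFn (Fin.tail E)) * _ + _ = _
    ring

lemma take_ofFn {m s : ℕ} (h : s ≤ m) (E : Fin m → Cochain 𝒵 𝒜) :
    (List.ofFn E).take s = List.ofFn (initial h E) := by
  refine List.ext_getElem (by simp [h]) fun i h1 h2 => ?_
  simp [initial]

lemma seg_eq_drop {m : ℕ} (s : ℕ) (E : Fin m → Cochain 𝒵 𝒜) :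
    seg E s m = (List.ofFn E).drop s := by
  rw [seg, List.take_of_length_le (by simp)]

lemma drop_ofFn {m s : ℕ} (h : s < m) (E : Fin m → Cochain 𝒵 𝒜) :
    (List.ofFn E).drop s = E ⟨s, h⟩ :: seg E (s + 1) m := by
  rw [seg_eq_drop, List.drop_eq_getElem_cons (by simpa using h)]
  simp

end CyclicBrace

end

/-! ### The cyclic brace relations -/

open CyclicBrace in
open CyclicBrace in
theorem theorem1p4 {𝕜 : Type*} [CommRing 𝕜]
    {A : Type*} [AddCommGroup A] [Module 𝕜 A] {Z : Type*} [AddCommGroup Z] [Module 𝕜 Z]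
    (𝒜 : ℤ → Submodule 𝕜 A) [DirectSum.Decomposition 𝒜]
    (𝒵 : ℤ → Submodule 𝕜 Z) [DirectSum.Decomposition 𝒵]
    (ω : NondegForm 𝒜) (one : 𝒜 (-1))
    (m n : ℕ) (D : Cochain 𝒵 𝒜) (E : Fin m → Cochain 𝒵 𝒜) (F : Fin n → Cochain 𝒵 𝒜) :
    -- (i)
    (brace₁ ω one (brace D (List.ofFn E)) (List.ofFn F) []).toFun =
        ∑ s : Fin (m + 1), ∑ p ∈ interlaced n 0 s,
          (weaveSign 0 (initial s.is_le E) F p.1 + segDeg E s m * segDeg F 0 n).negOnePow •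
            (brace₁ ω one D
              (weave 0 (initial s.is_le E) F p.1 p.2 ++ seg F (ext₀ 0 p.2 (Fin.last s)) n)
              (seg E s m)).toFun
      + ∑ s : Fin m, ∑ p ∈ interlaced n 0 s,
          ∑ i ∈ Finset.Icc (ext₀ 0 p.2 (Fin.last s)) n,
          (weaveSign 0 (initial s.is_lt.le E) F p.1 + (E s).deg * segDeg F 0 i
              + segDeg E (s + 1) m * segDeg F 0 n).negOnePow •
            (brace₂ ω one D
              (weave 0 (initial s.is_lt.le E) F p.1 p.2 ++ seg F (ext₀ 0 p.2 (Fin.last s)) i)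
              (E s) (seg F i n) []
              (seg E (s + 1) m)).toFun
    ∧
    -- (ii)
    (brace (brace₁ ω one D (List.ofFn E) []) (List.ofFn F)).toFun =
        ∑ r ∈ Finset.range (n + 1), ∑ p ∈ interlaced n r m,
          (weaveSign r E F p.1 + segDeg F 0 r * segDeg F r n).negOnePow •
            (brace₁ ω one D
              (weave r E F p.1 p.2 ++ seg F (ext₀ r p.2 (Fin.last m)) n)
              (seg F 0 r)).toFun := by
  have hu (u : ℤˣ) (f : ZWord 𝒵 → AWord 𝒜 Unit → A) (zs : ZWord 𝒵) (as : AWord 𝒜 Unit) :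
      (u • f) zs as = u • f zs as := rfl
  constructor
  · funext zs as
    simp only [Pi.add_apply, Finset.sum_apply, hu]
    rw [brace₁, cyc_brace_brace, anchored, List.map_nil,
      weaveSum_append_singleton _ _ _ rfl (fun W => (cyc ω one (brace D W)).toFun zs as)]
    simp only [weaveSum_map_lift, degs_map_lift, ← seg_full F]
    congr 1
    -- `Δ` is a direct argument of `D`; the cut position `s` counts the `E`'s that precede it.
    · rw [cutSum, List.length_ofFn, Finset.sum_range]
      refine Finset.sum_congr rfl fun s _ => ?_
      rw [take_ofFn s.is_le, weaveSum_ofFn _ _ (Nat.zero_le n), Finset.smul_sum]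
      refine Finset.sum_congr rfl fun p _ => ?_
      rw [smul_smul, ← Int.negOnePow_add, add_comm, ← seg_eq_drop]
      simp only [brace₁, anchored, List.map_append, segDeg_eq_degs]
    -- The cut at `m` leaves no operation to contain `◊`, so its `headSum` is zero and `s` ranges
    -- over `Fin m`; counted from zero, the operation that contains `◊` is `E s`.
    · rw [cutSum, List.length_ofFn, Finset.sum_range_succ, List.drop_of_length_le (by simp),
        headSum_nil, add_zero, Finset.sum_range]
      refine Finset.sum_congr rfl fun s _ => ?_
      rw [take_ofFn s.is_lt.le, drop_ofFn s.is_lt, headSum_cons,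
        weaveSum_ofFn _ _ (Nat.zero_le n), Finset.smul_sum]
      refine Finset.sum_congr rfl fun p _ => ?_
      -- The cut of the tail supplies the last index `i`: the `F`'s after position `i` enter the
      -- brace of `E s` together with `◊`.
      rw [cutSum_map, cutSum_seg F (ext₀_le (Nat.zero_le n) _ _), Finset.smul_sum, Finset.smul_sum]
      refine Finset.sum_congr rfl fun i hi => ?_
      have hi' : i ≤ n := (Finset.mem_Icc.1 hi).2
      -- The total degree of the `F`'s minus that of those inside `E s` is the degree of `F₁, …,
      -- F_i`, the ones that `E s` passes.
      rw [smul_smul, smul_smul, ← Int.negOnePow_add, ← Int.negOnePow_add, degs_map_lift,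
        ← segDeg_eq_degs F 0 n, ← segDeg_eq_degs F i n, ← segDeg_add F (Nat.zero_le i) hi',
        add_sub_cancel_right]
      simp only [brace₂, anchored, List.map_append, List.append_assoc, List.map_nil]
      congr 2
      rw [← segDeg_eq_degs]
      ring
  · funext zs as
    simp only [Finset.sum_apply, hu]
    -- The cut position `r` is the number of `F`'s that are moved behind `Δ`.
    rw [brace_brace₁, cutSum, List.length_ofFn]
    refine Finset.sum_congr rfl fun r hr => ?_
    have hr' : r ≤ n := by simpa [Nat.lt_succ_iff] using hr
    have h : (List.ofFn F).take r = seg F 0 r := by rw [seg, List.drop_zero]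
    rw [h, ← seg_eq_drop, weaveSum_ofFn _ _ hr', Finset.smul_sum]
    refine Finset.sum_congr rfl fun p _ => ?_
    rw [smul_smul, ← Int.negOnePow_add, add_comm]
    rfl
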